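/- Let $k$ be a field that is finitely generated (as a field) over $\mathbb{Q}$. For a proper, smooth, geometrically connected algebraic curve $X$ over $k$ with function field $K_X$, let $K_X^{\mathrm{sep}}$ be a separable closure of $K_X$, let $\bar k$ be the algebraic closure of $k$ in $K_X^{\mathrm{sep}}$, and put $G_X=\mathrm{Gal}(K_X^{\mathrm{sep}}/K_X)$, $G_k=\mathrm{Gal}(\bar k/k)$, with $\mathrm{pr}_X:G_X\to G_k$ the restriction map. For a rational point $x\in X(k)$, a decomposition subgroup $D_x\subset G_X$ associated to $x$ is the stabiliser in $G_X$ of a valuation ring of $K_X^{\mathrm{sep}}$ whose intersection with $K_X$ is the local ring $\mathcal{O}_{X,x}$ (it is well defined up to conjugation). We say that the birational Grothendieck anabelian section conjecture (BGASC) holds true for $X$ if for every continuous homomorphism $s:G_k\to G_X$ with $\mathrm{pr}_X\circ s=\mathrm{id}_{G_k}$ there is a unique rational point $x\in X(k)$ such that the image $s(G_k)$ is contained in a decomposition subgroup $D_x$ associated to $x$. Corollary 2.3. Let $k$ be a field finitely generated over $\mathbb{Q}$, and let $g\ge 1$ be an integer. Assume that the BGASC holds true for every proper, smooth, geometrically connected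 curve of genus $g$ over $k$. Then the BGASC holds true for every projective, smooth, geometrically connected curve $X$ over $k$ (of any genus; for curves, projective and proper are equivalent). -/

import Mathlib

open CategoryTheory AlgebraicGeometry
open scoped KaehlerDifferential

universe u

noncomputable section

/-! ### Sections of the projection of absolute Galois groups

Here `K` is an extension field of `k` and `Ω` is an extension field of `K`; in the application `K`
is the function field of a curve over `k` and `Ω` is a separable closure of `K`. -/

section Galois

variable (k K Ω : Type*) [Field k] [Field K] [Field Ω] [Algebra k K] [Algebra K Ω] [Algebra k Ω]
  [IsScalarTower k K Ω]

/-- The projection `pr : Gal(Ω/K) → Gal(k̄/k)`, where `k̄` is the algebraic closure of `k` in `Ω`: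
restriction of automorphisms from `Ω` to `k̄`. -/
def galoisProj : Gal(Ω/K) →* Gal(algebraicClosure k Ω/k) where
  toFun σ := algebraicClosure.algEquivOfAlgEquiv (σ.restrictScalars k)
  map_one' := rfl
  map_mul' _ _ := rfl

/-- A group-theoretic section of `pr : Gal(Ω/K) → Gal(k̄/k)`: a continuous homomorphism
`s : Gal(k̄/k) → Gal(Ω/K)` with `pr ∘ s = id` (both groups carry the Krull topology). -/
structure GaloisSection where
  toHom : Gal(algebraicClosure k Ω/k) →* Gal(Ω/K)
  continuous_toHom : Continuous toHom
  proj_comp : (galoisProj k K Ω).comp toHom = MonoidHom.id _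

end Galois

/-- A proper, smooth and geometrically connected algebraic curve over the field `k`: an integral
scheme with a proper morphism to `Spec k` which is smooth of relative dimension one and
geometrically connected.  (Integrality is in fact implied by the other conditions; it is recorded
as a field so that the function field is available.) -/
structure SmoothProperCurve (k : Type u) [Field k] where
  X : Scheme.{u}
  π : X ⟶ Spec (CommRingCat.of k)
  isIntegral : IsIntegral X
  isProper : IsProper π
  smooth : SmoothOfRelativeDimension 1 π
  geometricallyConnected : GeometricallyConnected π

namespace SmoothProperCurve

variable {k : Type u} [Field k] (C : SmoothProperCurve k)

instance : IsIntegral C.X := C.isIntegral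

/-- The function field `K_X` of the curve. -/
abbrev FunctionField : Type u := C.X.functionField

/-- The embedding of the base field `k` in the function field, induced by the structure morphism. -/
def baseToFunctionField : k →+* C.FunctionField :=
  ((Scheme.ΓSpecIso (CommRingCat.of k)).inv ≫ C.π.appTop ≫
    C.X.presheaf.germ ⊤ (genericPoint C.X) (TopologicalSpace.Opens.mem_top _)).hom

instance : Algebra k C.FunctionField := C.baseToFunctionField.toAlgebra

/-- The local ring `𝒪_{X,x}`, as a subring of the function field. -/
def localRing (x : C.X) : Subring C.FunctionField :=
  (algebraMap (C.X.presheaf.stalk x) C.X.functionField).range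

/-- The differentials of `K_X` over `k` that are regular at the point `x`: the image of
`Ω_{𝒪_{X,x}/k}` in `Ω_{K_X/k}`, i.e. the finite sums of `a • d b` with `a, b ∈ 𝒪_{X,x}`. -/
def differentialsRegularAt (x : C.X) : Submodule k Ω[C.FunctionField⁄k] :=
  Submodule.span k
    {ω | ∃ a ∈ C.localRing x, ∃ b ∈ C.localRing x,
      ω = a • KaehlerDifferential.D k C.FunctionField b}

/-- The `k`-vector space `H⁰(X, Ω¹_{X/k})` of global regular differentials, realised as the space of
differentials of the function field that are regular at every point. -/
def globalDifferentials : Submodule k Ω[C.FunctionField⁄k] :=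
  ⨅ x : C.X, C.differentialsRegularAt x

/-- The genus of the curve: the dimension of the space of global regular differentials. -/
def genus : ℕ := Module.finrank k C.globalDifferentials

/-- The set `X(k)` of rational points: sections of the structure morphism. -/
def RationalPoint : Type u := {x : Spec (CommRingCat.of k) ⟶ C.X // x ≫ C.π = 𝟙 _}

/-- The point of the underlying topological space defined by a rational point. -/
def RationalPoint.pt {C : SmoothProperCurve k} (x : C.RationalPoint) : C.X :=
  x.1 (IsLocalRing.closedPoint k)

/-- The separable closure `K_X^sep` of the function field. -/
abbrev SepClosure : Type u := SeparableClosure C.FunctionField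

/-- `D` is a decomposition subgroup of `G_X = Gal(K_X^sep/K_X)` associated to the rational point
`x`: the stabiliser of a valuation ring of `K_X^sep` that lies above the discrete valuation ring
`𝒪_{X,x}` of `K_X`.  (Different choices of the valuation ring give conjugate subgroups.) -/
def IsDecompositionSubgroup (x : C.RationalPoint)
    (D : Subgroup Gal(C.SepClosure/C.FunctionField)) : Prop :=
  ∃ V : ValuationSubring C.SepClosure,
    (V.comap (algebraMap C.FunctionField C.SepClosure)).toSubring = C.localRing x.pt ∧
      D = V.decompositionSubgroup C.FunctionField

/-- The birational Grothendieck anabelian section conjecture holds true for the curve: the image of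
every section `s : G_k → G_X` is contained in a decomposition subgroup associated to a unique
rational point. -/
def BGASC : Prop :=
  ∀ s : GaloisSection k C.FunctionField C.SepClosure,
    ∃! x : C.RationalPoint, ∃ D : Subgroup Gal(C.SepClosure/C.FunctionField),
      C.IsDecompositionSubgroup x D ∧ s.toHom.range ≤ D

end SmoothProperCurve

end

/-! Fix a section `s` and let `G_k` act on `Ω = K_X^sep` through `s`. A stable place is a nontrivial
valuation ring of `Ω` that contains `k` and is preserved by this action. The conjecture for `X` says
exactly that every `s` has a stable place and that all stable places of `s` have the same
restriction to `K_X` (`bgasc_iff_isStablePlace`). The point is that a stable place always lies over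
a rational point. Let `a ∈ K_X ∩ V` be transcendental. Some `a - c` with `c` algebraic over `k` lies
in the maximal ideal, as otherwise `V` would contain `k(a)` and hence all of `Ω`. Such a `c` is
unique, hence fixed by the Galois action, hence in `k`. So the restriction to `K_X` has residue
field `k`; properness gives it a centre on `X`, and smoothness identifies it with the local ring
there.

The notion of a stable place depends only on `Ω` with its action of `G_k`, not on `K_X`. So `K_X`
may be replaced by the function field of any curve `Y` that embeds in the fixed elements of `Ω`,
provided that `Ω` is algebraic over it (`exists_isStablePlace_of_bgasc`).

Given a transcendental `t ∈ K_X`, Kummer theory yields `c ∈ k` nonzero and `y ∈ Ω` fixed by `s` with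
`y² = c(t^(2g+2) + 1)` (`exists_twist`). The field `k(t, y)` is the function field of a
hyperelliptic curve of genus `g`. The hypothesis for this curve produces a stable place of `s` and
shows that two stable places contain `t` simultaneously. As `t` was arbitrary and elements algebraic
over `k` lie in every stable place, all stable places agree on `K_X`.

The remaining work is to realise `k(t, y)` by a smooth proper curve of the right genus
(`exists_genus_eq_and_fieldRange_eq`). Two affine charts inside a field are glued, the valuative
criterion gives properness, and the regular differentials turn out to be `p(x) dx / y` with `deg p <
g`. -/

/-! ### Gluing two affine charts inside a field to a proper integral scheme -/

open Limits in
theorem exists_glue_of_isOpenImmersion {U₁ U₂ W : Scheme.{u}} (j₁ : W ⟶ U₁) (j₂ : W ⟶ U₂)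
    [IsOpenImmersion j₁] [IsOpenImmersion j₂] :
    ∃ (X : Scheme.{u}) (i₁ : U₁ ⟶ X) (i₂ : U₂ ⟶ X), IsOpenImmersion i₁ ∧ IsOpenImmersion i₂ ∧
      j₁ ≫ i₁ = j₂ ≫ i₂ ∧ (∀ x : X, x ∈ Set.range i₁ ∨ x ∈ Set.range i₂) ∧
      (∀ x₁ x₂, i₁ x₁ = i₂ x₂ → ∃ w, j₁ w = x₁ ∧ j₂ w = x₂) ∧
      ∀ (Z : Scheme.{u}) (f₁ : U₁ ⟶ Z) (f₂ : U₂ ⟶ Z), j₁ ≫ f₁ = j₂ ≫ f₂ →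
        ∃ f : X ⟶ Z, i₁ ≫ f = f₁ ∧ i₂ ≫ f = f₂ := by
  -- The gluing is the colimit of the span. Since the span is locally directed and consists of open
  -- immersions, the points of the colimit and their identifications are explicit.
  let F : WalkingSpan ⥤ Scheme.{u} := span j₁ j₂
  have hF : ∀ {i j : WalkingSpan} (f : i ⟶ j), IsOpenImmersion (F.map f) := by
    rintro i j (_ | _ | _)
    · change IsOpenImmersion (F.map (𝟙 i)); infer_instance
    · assumption
    · assumption
  have hl : (F ⋙ Scheme.forget).IsLocallyDirected := inferInstance
  have h (i) : IsOpenImmersion (colimit.ι F i) :=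
    (Scheme.IsLocallyDirected.openCover F).map_prop i
  refine ⟨colimit F, colimit.ι F .left, colimit.ι F .right, h _, h _, ?_, ?_,
    ?_, ?_⟩
  · exact (colimit.w F WalkingSpan.Hom.fst).trans (colimit.w F WalkingSpan.Hom.snd).symm
  · intro x
    obtain ⟨(_ | _ | _), y, hy⟩ := Scheme.IsLocallyDirected.ι_jointly_surjective F x
    · refine .inl ⟨j₁ y, ?_⟩
      rw [← hy, ← colimit.w F WalkingSpan.Hom.fst]
      rfl
    · exact .inl ⟨y, hy⟩
    · exact .inr ⟨y, hy⟩
  · intro x₁ x₂ h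
    obtain ⟨k, f, g, y, hf, hg⟩ := (Scheme.IsLocallyDirected.ι_eq_ι_iff F).1 h
    rcases k with (_ | _ | _)
    · obtain rfl : f = WalkingSpan.Hom.fst := Subsingleton.elim _ _
      obtain rfl : g = WalkingSpan.Hom.snd := Subsingleton.elim _ _
      exact ⟨y, hf, hg⟩
    · exact nomatch (show WidePushoutShape.Hom _ _ from g)
    · exact nomatch (show WidePushoutShape.Hom _ _ from f)
  · intro Z f₁ f₂ h
    exact ⟨pushout.desc f₁ f₂ h, pushout.inl_desc _ _ _, pushout.inr_desc _ _ _⟩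

/-- A morphism from the spectrum of a local ring whose closed point lands in an affine open chart
factors through the chart. -/
theorem exists_ringHom_of_closedPoint_mem_range {X : Scheme.{u}} {A R : Type u} [CommRing A]
    [CommRing R] [IsLocalRing R] (f : Spec (CommRingCat.of R) ⟶ X)
    (i : Spec (CommRingCat.of A) ⟶ X) [IsOpenImmersion i]
    (h : f (IsLocalRing.closedPoint R) ∈ Set.range i) :
    ∃ φ : A →+* R, f = Spec.map (CommRingCat.ofHom φ) ≫ i := by
  have hr : Set.range f ⊆ Set.range i := by
    have h1 : f ⁻¹ᵁ i.opensRange = ⊤ := IsLocalRing.closed_point_mem_iff.1 h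
    rintro _ ⟨y, rfl⟩
    have h2 : y ∈ f ⁻¹ᵁ i.opensRange := h1 ▸ trivial
    exact h2
  refine ⟨(Spec.preimage (IsOpenImmersion.lift i f hr)).hom, ?_⟩
  rw [CommRingCat.ofHom_hom, Spec.map_preimage, IsOpenImmersion.lift_fac]

/-- Two finitely generated subalgebras of a field that agree after inverting `x` in the first and
`x⁻¹` in the second one, and that are integral over `k[x]` and `k[x⁻¹]` respectively. -/
structure IsChartPair {k F : Type u} [Field k] [Field F] [Algebra k F] (A₁ A₂ B : Subalgebra k F)
    (x : F) : Prop where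
  ne_zero : x ≠ 0
  le₁ : A₁ ≤ B
  le₂ : A₂ ≤ B
  mem₁ : x ∈ A₁
  mem₂ : x⁻¹ ∈ A₂
  loc₁ : ∀ b ∈ B, ∃ n : ℕ, b * x ^ n ∈ A₁
  loc₂ : ∀ b ∈ B, ∃ n : ℕ, b * x⁻¹ ^ n ∈ A₂
  int₁ : ∀ a ∈ A₁, IsIntegral (Algebra.adjoin k {x}) a
  int₂ : ∀ a ∈ A₂, IsIntegral (Algebra.adjoin k {x⁻¹}) a
  fg₁ : A₁.FG
  fg₂ : A₂.FG

section Glue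

variable {k F : Type u} [Field k] [Field F] [Algebra k F] {A₁ A₂ B : Subalgebra k F} {x : F}

theorem IsChartPair.symm (h : IsChartPair A₁ A₂ B x) : IsChartPair A₂ A₁ B x⁻¹ where
  ne_zero := inv_ne_zero h.ne_zero
  le₁ := h.le₂
  le₂ := h.le₁
  mem₁ := h.mem₂
  mem₂ := by simpa using h.mem₁
  loc₁ := h.loc₂
  loc₂ := by simpa using h.loc₁
  int₁ := h.int₂
  int₂ := by rw [inv_inv]; exact h.int₁
  fg₁ := h.fg₂
  fg₂ := h.fg₁

/-- The morphism of spectra defined by an inclusion of subalgebras. -/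
noncomputable abbrev specInclusion {A B : Subalgebra k F} (h : A ≤ B) :
    Spec (CommRingCat.of B) ⟶ Spec (CommRingCat.of A) :=
  Spec.map (CommRingCat.ofHom (Subalgebra.inclusion h).toRingHom)

theorem IsChartPair.isLocalization (h : IsChartPair A₁ A₂ B x) :
    @IsLocalization.Away A₁ _ ⟨x, h.mem₁⟩ B _ (Subalgebra.inclusion h.le₁).toRingHom.toAlgebra := by
  let := (Subalgebra.inclusion h.le₁).toRingHom.toAlgebra
  have hmap (a : A₁) : (algebraMap A₁ B a : F) = a := rfl
  have hxB : x⁻¹ ∈ B := h.le₂ h.mem₂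
  refine ⟨?_, ?_, ?_⟩
  · rintro ⟨_, n, rfl⟩
    rw [map_pow]
    refine IsUnit.pow _ (IsUnit.of_mul_eq_one ⟨x⁻¹, hxB⟩ (Subtype.ext ?_))
    exact mul_inv_cancel₀ h.ne_zero
  · intro b
    obtain ⟨n, hn⟩ := h.loc₁ b b.2
    refine ⟨(⟨_, hn⟩, ⟨_, n, rfl⟩), Subtype.ext ?_⟩
    simp [hmap]
  · intro a b hab
    refine ⟨1, ?_⟩
    have := congr_arg (Subtype.val : B → F) hab
    rw [hmap, hmap] at this
    simpa using Subtype.ext this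

theorem IsChartPair.isOpenImmersion (h : IsChartPair A₁ A₂ B x) :
    IsOpenImmersion (specInclusion h.le₁) := by
  let := (Subalgebra.inclusion h.le₁).toRingHom.toAlgebra
  have := h.isLocalization
  exact IsOpenImmersion.of_isLocalization (⟨x, h.mem₁⟩ : A₁)

/-- A ring homomorphism on the first chart which maps `x` to a unit extends to the overlap. -/
theorem IsChartPair.exists_extend (h : IsChartPair A₁ A₂ B x) {R : Type*} [CommRing R]
    (φ : A₁ →+* R) (hφ : IsUnit (φ ⟨x, h.mem₁⟩)) :
    ∃ ψ : B →+* R, ψ.comp (Subalgebra.inclusion h.le₁).toRingHom = φ := by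
  let := (Subalgebra.inclusion h.le₁).toRingHom.toAlgebra
  have := h.isLocalization
  exact ⟨IsLocalization.Away.lift (⟨x, h.mem₁⟩ : A₁) hφ, IsLocalization.Away.lift_comp _ hφ⟩

theorem IsChartPair.hom_ext (h : IsChartPair A₁ A₂ B x) {R : Type*} [CommRing R]
    {φ ψ : B →+* R} (H : φ.comp (Subalgebra.inclusion h.le₁).toRingHom =
      ψ.comp (Subalgebra.inclusion h.le₁).toRingHom) : φ = ψ := by
  let := (Subalgebra.inclusion h.le₁).toRingHom.toAlgebra
  have := h.isLocalization
  exact IsLocalization.ringHom_ext (Submonoid.powers (⟨x, h.mem₁⟩ : A₁)) H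

/-- `X` is the `k`-scheme obtained by gluing the spectra of the two charts. -/
structure IsGlueOf (A₁ A₂ B : Subalgebra k F) (le₁ : A₁ ≤ B) (le₂ : A₂ ≤ B) {X : Scheme.{u}}
    (π : X ⟶ Spec (CommRingCat.of k)) (i₁ : Spec (CommRingCat.of A₁) ⟶ X)
    (i₂ : Spec (CommRingCat.of A₂) ⟶ X) : Prop where
  open₁ : IsOpenImmersion i₁
  open₂ : IsOpenImmersion i₂
  over₁ : i₁ ≫ π = Spec.map (CommRingCat.ofHom (algebraMap k A₁))
  over₂ : i₂ ≫ π = Spec.map (CommRingCat.ofHom (algebraMap k A₂))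
  glue : specInclusion le₁ ≫ i₁ = specInclusion le₂ ≫ i₂
  cover : ∀ x : X, x ∈ Set.range i₁ ∨ x ∈ Set.range i₂
  overlap : ∀ x₁ x₂, i₁ x₁ = i₂ x₂ → ∃ w, specInclusion le₁ w = x₁ ∧ specInclusion le₂ w = x₂

theorem IsChartPair.exists_glue (h : IsChartPair A₁ A₂ B x) :
    ∃ (X : Scheme.{u}) (π : X ⟶ Spec (CommRingCat.of k)) (i₁ : Spec (CommRingCat.of A₁) ⟶ X)
      (i₂ : Spec (CommRingCat.of A₂) ⟶ X), IsGlueOf A₁ A₂ B h.le₁ h.le₂ π i₁ i₂ := by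
  have := h.isOpenImmersion
  have := h.symm.isOpenImmersion
  obtain ⟨X, i₁, i₂, ho₁, ho₂, hg, hc, hov, hd⟩ :=
    exists_glue_of_isOpenImmersion (specInclusion h.le₁) (specInclusion h.le₂)
  obtain ⟨π, h₁, h₂⟩ := hd _ (Spec.map (CommRingCat.ofHom (algebraMap k A₁)))
    (Spec.map (CommRingCat.ofHom (algebraMap k A₂))) (by
      simp only [← Spec.map_comp, ← CommRingCat.ofHom_comp]
      rfl)
  exact ⟨X, π, i₁, i₂, ho₁, ho₂, h₁, h₂, hg, hc, hov⟩

namespace IsGlueOf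

variable {le₁ : A₁ ≤ B} {le₂ : A₂ ≤ B} {X : Scheme.{u}} {π : X ⟶ Spec (CommRingCat.of k)}
  {i₁ : Spec (CommRingCat.of A₁) ⟶ X} {i₂ : Spec (CommRingCat.of A₂) ⟶ X}

theorem symm (H : IsGlueOf A₁ A₂ B le₁ le₂ π i₁ i₂) : IsGlueOf A₂ A₁ B le₂ le₁ π i₂ i₁ where
  open₁ := H.open₂
  open₂ := H.open₁
  over₁ := H.over₂
  over₂ := H.over₁
  glue := H.glue.symm
  cover x := (H.cover x).symm
  overlap x₁ x₂ e := by
    obtain ⟨w, h₁, h₂⟩ := H.overlap x₂ x₁ e.symm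
    exact ⟨w, h₂, h₁⟩

/-- If `x` lands in the valuation ring `R`, so does `k[x]`, and then so does `A₁`, because it is
integral over `k[x]` and `R` is integrally closed. The lift therefore exists within the first chart.
-/
theorem hasLift_of_mem_range (h : IsChartPair A₁ A₂ B x) (H : IsGlueOf A₁ A₂ B le₁ le₂ π i₁ i₂)
    (S : ValuativeCommSq π) (φ : A₁ →+* S.K) (hφ : S.i₁ = Spec.map (CommRingCat.ofHom φ) ≫ i₁)
    (hx : φ ⟨x, h.mem₁⟩ ∈ Set.range (algebraMap S.R S.K)) : S.commSq.HasLift := by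
  have hk : (algebraMap S.R S.K).comp (Spec.preimage S.i₂).hom = φ.comp (algebraMap k A₁) := by
    have hw := S.commSq.w
    rw [hφ, Category.assoc, H.over₁, ← Spec.map_preimage S.i₂, ← Spec.map_comp, ← Spec.map_comp]
      at hw
    exact (congr_arg CommRingCat.Hom.hom (Spec.map_injective hw)).symm
  have hR : ∀ a, φ a ∈ Set.range (algebraMap S.R S.K) := by
    have hadj : ∀ b (hb : b ∈ Algebra.adjoin k {x}) (hb' : b ∈ A₁),
        φ ⟨b, hb'⟩ ∈ Set.range (algebraMap S.R S.K) := by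
      intro b hb
      induction hb using Algebra.adjoin_induction with
      | mem y hy =>
        obtain rfl : y = x := hy
        exact fun _ ↦ hx
      | algebraMap r => exact fun _ ↦ ⟨_, RingHom.congr_fun hk r⟩
      | add y z hy hz h₁ h₂ =>
        have le : Algebra.adjoin k {x} ≤ A₁ := Algebra.adjoin_le (by simpa using h.mem₁)
        intro _
        obtain ⟨a, ha⟩ := h₁ (le hy)
        obtain ⟨b, hb⟩ := h₂ (le hz)
        exact ⟨a + b, by rw [map_add, ha, hb, ← map_add]; rfl⟩
      | mul y z hy hz h₁ h₂ =>
        have le : Algebra.adjoin k {x} ≤ A₁ := Algebra.adjoin_le (by simpa using h.mem₁)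
        intro _
        obtain ⟨a, ha⟩ := h₁ (le hy)
        obtain ⟨b, hb⟩ := h₂ (le hz)
        exact ⟨a * b, by rw [map_mul, ha, hb, ← map_mul]; rfl⟩
    intro a
    have le : Algebra.adjoin k {x} ≤ A₁ := Algebra.adjoin_le (by simpa using h.mem₁)
    obtain ⟨p, hp, hpa⟩ := h.int₁ a a.2
    have hint : IsIntegral S.R (φ a) := by
      have h1 : (φ.comp (Subalgebra.inclusion le).toRingHom).IsIntegralElem (φ a) := by
        refine ⟨p, hp, ?_⟩
        rw [← Polynomial.hom_eval₂, ← map_zero φ]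
        congr 1
        apply Subtype.ext
        exact (Polynomial.hom_eval₂ p _ A₁.val.toRingHom a).trans hpa
      have h2 : ∃ ψ : Algebra.adjoin k {x} →+* S.R,
          (algebraMap S.R S.K).comp ψ = φ.comp (Subalgebra.inclusion le).toRingHom := by
        have h3 : ∀ b, (φ.comp (Subalgebra.inclusion le).toRingHom) b ∈
            (algebraMap S.R S.K).range := fun b ↦ hadj b b.2 (le b.2)
        let e := RingEquiv.ofBijective (algebraMap S.R S.K).rangeRestrict
          ⟨fun a b hab ↦ IsFractionRing.injective S.R S.K (congr_arg Subtype.val hab),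
            (algebraMap S.R S.K).rangeRestrict_surjective⟩
        refine ⟨e.symm.toRingHom.comp (RingHom.codRestrict _ _ h3), ?_⟩
        ext b
        exact congr_arg Subtype.val (e.apply_symm_apply _)
      obtain ⟨ψ, hψ⟩ := h2
      obtain ⟨p, hp, hp0⟩ := h1
      refine ⟨p.map ψ, hp.map ψ, ?_⟩
      rw [Polynomial.eval₂_map, hψ, hp0]
    exact IsIntegrallyClosed.isIntegral_iff.1 hint
  have hlift : ∃ ψ : A₁ →+* S.R, (algebraMap S.R S.K).comp ψ = φ := by
    let e := RingEquiv.ofBijective (algebraMap S.R S.K).rangeRestrict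
      ⟨fun a b hab ↦ IsFractionRing.injective S.R S.K (congr_arg Subtype.val hab),
        (algebraMap S.R S.K).rangeRestrict_surjective⟩
    refine ⟨e.symm.toRingHom.comp (RingHom.codRestrict φ (algebraMap S.R S.K).range hR), ?_⟩
    ext b
    exact congr_arg Subtype.val (e.apply_symm_apply _)
  obtain ⟨ψ, hψ⟩ := hlift
  refine ⟨⟨⟨Spec.map (CommRingCat.ofHom ψ) ≫ i₁, ?_, ?_⟩⟩⟩
  · rw [← Category.assoc, ← Spec.map_comp, ← CommRingCat.ofHom_comp, hψ, hφ]
  · rw [Category.assoc, H.over₁, ← Spec.map_comp, ← CommRingCat.ofHom_comp,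
      ← Spec.map_preimage S.i₂]
    congr 1
    ext r
    apply IsFractionRing.injective S.R S.K
    refine Eq.trans ?_ (RingHom.congr_fun hk r).symm
    exact RingHom.congr_fun hψ _

/-- A valuation ring contains the image of `x` or its inverse. In the second case the image is
nonzero, so the generic point lies in the overlap and the lift is found in the second chart. -/
theorem hasLift_of_chart (h : IsChartPair A₁ A₂ B x) (H : IsGlueOf A₁ A₂ B le₁ le₂ π i₁ i₂)
    (S : ValuativeCommSq π) (φ : A₁ →+* S.K)
    (hφ : S.i₁ = Spec.map (CommRingCat.ofHom φ) ≫ i₁) : S.commSq.HasLift := by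
  by_cases hx : φ ⟨x, h.mem₁⟩ ∈ Set.range (algebraMap S.R S.K)
  · exact hasLift_of_mem_range h H S φ hφ hx
  have hx0 : φ ⟨x, h.mem₁⟩ ≠ 0 := fun h0 ↦ hx ⟨0, by rw [h0, map_zero]⟩
  obtain ⟨ψ, hψ⟩ := h.exists_extend φ hx0.isUnit
  refine hasLift_of_mem_range h.symm H.symm S (ψ.comp (Subalgebra.inclusion le₂).toRingHom) ?_ ?_
  · rw [hφ, ← hψ, CommRingCat.ofHom_comp, CommRingCat.ofHom_comp, Spec.map_comp, Spec.map_comp,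
      Category.assoc, Category.assoc]
    exact congr_arg _ H.glue
  · have hmul :
        φ ⟨x, h.mem₁⟩ * (ψ.comp (Subalgebra.inclusion le₂).toRingHom) ⟨x⁻¹, h.mem₂⟩ = 1 := by
      rw [← hψ]
      refine (map_mul ψ _ _).symm.trans ((congr_arg ψ (Subtype.ext ?_)).trans (map_one ψ))
      exact mul_inv_cancel₀ h.ne_zero
    rw [eq_inv_of_mul_eq_one_right hmul]
    obtain ⟨r, hr⟩ | ⟨r, hr⟩ := ValuationRing.isInteger_or_isInteger S.R (φ ⟨x, h.mem₁⟩)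
    · exact absurd ⟨r, hr⟩ hx
    · exact ⟨r, hr⟩

/-- This is separatedness across the charts. The relation `x · x⁻¹ = 1` holds in `K`, hence in `R`,
so `ψ₁` maps `x` to a unit of `R` and both lifts factor through the overlap, where they agree
because `R → K` is injective. -/
theorem lift_eq_of_charts (h : IsChartPair A₁ A₂ B x) (H : IsGlueOf A₁ A₂ B le₁ le₂ π i₁ i₂)
    {R K : Type u} [CommRing R] [IsDomain R] [IsLocalRing R] [Field K] [Algebra R K]
    [IsFractionRing R K] (ψ₁ : A₁ →+* R) (ψ₂ : A₂ →+* R)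
    (e : Spec.map (CommRingCat.ofHom (algebraMap R K)) ≫ Spec.map (CommRingCat.ofHom ψ₁) ≫ i₁ =
      Spec.map (CommRingCat.ofHom (algebraMap R K)) ≫ Spec.map (CommRingCat.ofHom ψ₂) ≫ i₂) :
    Spec.map (CommRingCat.ofHom ψ₁) ≫ i₁ = Spec.map (CommRingCat.ofHom ψ₂) ≫ i₂ := by
  have := H.open₁
  have := H.open₂
  have := h.isOpenImmersion
  have : IsOpenImmersion (specInclusion le₁) := this
  rw [← Spec.map_comp_assoc, ← Spec.map_comp_assoc, ← CommRingCat.ofHom_comp,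
    ← CommRingCat.ofHom_comp] at e
  obtain ⟨w, hw, -⟩ := H.overlap _ _ (congr($e (IsLocalRing.closedPoint K)))
  obtain ⟨φ, hφ⟩ := exists_ringHom_of_closedPoint_mem_range
    (Spec.map (CommRingCat.ofHom ((algebraMap R K).comp ψ₁))) (specInclusion le₁) ⟨w, hw⟩
  have h₁ : (algebraMap R K).comp ψ₁ = φ.comp (Subalgebra.inclusion le₁).toRingHom := by
    rw [← Spec.map_comp] at hφ
    exact congr_arg CommRingCat.Hom.hom (Spec.map_injective hφ)
  have h₂ : (algebraMap R K).comp ψ₂ = φ.comp (Subalgebra.inclusion le₂).toRingHom := by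
    rw [hφ, Category.assoc, H.glue, ← Category.assoc, cancel_mono, ← Spec.map_comp] at e
    exact (congr_arg CommRingCat.Hom.hom (Spec.map_injective e)).symm
  have hmul : ψ₁ ⟨x, h.mem₁⟩ * ψ₂ ⟨x⁻¹, h.mem₂⟩ = 1 := by
    apply IsFractionRing.injective R K
    rw [map_mul, map_one]
    refine (congr_arg₂ _ (RingHom.congr_fun h₁ _) (RingHom.congr_fun h₂ _)).trans
      ((map_mul φ _ _).symm.trans ((congr_arg φ (Subtype.ext ?_)).trans (map_one φ)))
    exact mul_inv_cancel₀ h.ne_zero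
  obtain ⟨ψ, hψ⟩ := h.exists_extend ψ₁ (IsUnit.of_mul_eq_one _ hmul)
  have hφψ : (algebraMap R K).comp ψ = φ := by
    apply h.hom_ext
    rw [RingHom.comp_assoc, hψ, h₁]
  have hψ₂ : ψ.comp (Subalgebra.inclusion le₂).toRingHom = ψ₂ := by
    ext a
    apply IsFractionRing.injective R K
    refine Eq.trans ?_ (RingHom.congr_fun h₂ a).symm
    exact RingHom.congr_fun hφψ _
  rw [← hψ, ← hψ₂, CommRingCat.ofHom_comp, CommRingCat.ofHom_comp, Spec.map_comp, Spec.map_comp,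
    Category.assoc, Category.assoc]
  exact congr_arg _ H.glue

theorem lift_eq_of_chart (H : IsGlueOf A₁ A₂ B le₁ le₂ π i₁ i₂)
    {R K : Type u} [CommRing R] [IsDomain R] [Field K] [Algebra R K]
    [IsFractionRing R K] (ψ₁ ψ₂ : A₁ →+* R)
    (e : Spec.map (CommRingCat.ofHom (algebraMap R K)) ≫ Spec.map (CommRingCat.ofHom ψ₁) ≫ i₁ =
      Spec.map (CommRingCat.ofHom (algebraMap R K)) ≫ Spec.map (CommRingCat.ofHom ψ₂) ≫ i₁) :
    Spec.map (CommRingCat.ofHom ψ₁) ≫ i₁ = Spec.map (CommRingCat.ofHom ψ₂) ≫ i₁ := by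
  have := H.open₁
  rw [← Category.assoc, ← Category.assoc, cancel_mono, ← Spec.map_comp, ← Spec.map_comp] at e
  have h := congr_arg CommRingCat.Hom.hom (Spec.map_injective e)
  congr 3
  ext a
  exact IsFractionRing.injective R K (RingHom.congr_fun h a)

theorem valuativeCriterion (h : IsChartPair A₁ A₂ B x) (H : IsGlueOf A₁ A₂ B le₁ le₂ π i₁ i₂) :
    ValuativeCriterion π := by
  have := H.open₁
  have := H.open₂
  refine ValuativeCriterion.iff.2 ⟨fun S ↦ ?_, fun S ↦ ⟨fun l m ↦ ?_⟩⟩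
  · rcases H.cover (S.i₁ (IsLocalRing.closedPoint S.K)) with hc | hc
    · obtain ⟨φ, hφ⟩ := exists_ringHom_of_closedPoint_mem_range S.i₁ i₁ hc
      exact hasLift_of_chart h H S φ hφ
    · obtain ⟨φ, hφ⟩ := exists_ringHom_of_closedPoint_mem_range S.i₁ i₂ hc
      exact hasLift_of_chart h.symm H.symm S φ hφ
  · have e := l.fac_left.trans m.fac_left.symm
    ext1
    rcases H.cover (l.l (IsLocalRing.closedPoint S.R)) with hl | hl <;>
    rcases H.cover (m.l (IsLocalRing.closedPoint S.R)) with hm | hm <;>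
    obtain ⟨φ, hφ⟩ := exists_ringHom_of_closedPoint_mem_range l.l _ hl <;>
    obtain ⟨ψ, hψ⟩ := exists_ringHom_of_closedPoint_mem_range m.l _ hm <;>
    rw [hφ, hψ] at e ⊢
    · exact lift_eq_of_chart H _ _ e
    · exact lift_eq_of_charts h H _ _ e
    · exact (lift_eq_of_charts h H _ _ e.symm).symm
    · exact lift_eq_of_chart H.symm _ _ e

open Limits in
/-- The open cover of a gluing by its two charts. -/
noncomputable def openCover (H : IsGlueOf A₁ A₂ B le₁ le₂ π i₁ i₂) : X.OpenCover where
  I₀ := Bool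
  X b := if b then Spec (CommRingCat.of A₁) else Spec (CommRingCat.of A₂)
  f b := match b with
    | true => i₁
    | false => i₂
  mem₀ := by
    rw [Scheme.presieve₀_mem_precoverage_iff]
    refine ⟨fun x ↦ ?_, ?_⟩
    · rcases H.cover x with h | h
      · exact ⟨true, h⟩
      · exact ⟨false, h⟩
    · rintro (_ | _)
      · exact H.open₂
      · exact H.open₁

theorem of_charts (H : IsGlueOf A₁ A₂ B le₁ le₂ π i₁ i₂) {P : MorphismProperty Scheme.{u}}
    {Q : ∀ {R S : Type u} [CommRing R] [CommRing S], (R →+* S) → Prop} [HasRingHomProperty P Q]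
    (h₁ : Q (algebraMap k A₁)) (h₂ : Q (algebraMap k A₂)) : P π := by
  rw [IsZariskiLocalAtSource.iff_of_openCover (P := P) H.openCover]
  rintro (_ | _)
  · change P (i₂ ≫ π)
    rwa [H.over₂, HasRingHomProperty.Spec_iff (P := P)]
  · change P (i₁ ≫ π)
    rwa [H.over₁, HasRingHomProperty.Spec_iff (P := P)]

theorem isProper (h : IsChartPair A₁ A₂ B x) (H : IsGlueOf A₁ A₂ B le₁ le₂ π i₁ i₂) :
    IsProper π := by
  have hft {A : Subalgebra k F} (hA : A.FG) : (algebraMap k A).FiniteType :=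
    RingHom.finiteType_algebraMap.2 (A.fg_iff_finiteType.1 hA)
  have hloc : LocallyOfFiniteType π :=
    H.of_charts (P := @LocallyOfFiniteType.{u}) (hft h.fg₁) (hft h.fg₂)
  -- The valuative criterion also needs `π` quasi-separated and quasi-compact; these come from local
  -- Noetherianity and from the two compact charts.
  have : IsLocallyNoetherian X := LocallyOfFiniteType.isLocallyNoetherian π
  have : CompactSpace X := by
    have hu : (Set.univ : Set X) = Set.range i₁ ∪ Set.range i₂ :=
      (Set.eq_univ_of_forall fun x ↦ H.cover x).symm
    rw [← isCompact_univ_iff, hu]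
    exact (isCompact_range i₁.continuous).union (isCompact_range i₂.continuous)
  exact IsProper.of_valuativeCriterion π (valuativeCriterion h H)

theorem genericPoint_specializes (_ : IsGlueOf A₁ A₂ B le₁ le₂ π i₁ i₂)
    (h : IsChartPair A₁ A₂ B x) (y : Spec (CommRingCat.of A₁)) :
    i₁ (specInclusion le₁ (genericPoint (Spec (CommRingCat.of B)))) ⤳ i₁ y := by
  have := h.isOpenImmersion
  rw [genericPoint_eq_of_isOpenImmersion (specInclusion le₁)]
  exact ((genericPoint_spec _).specializes trivial).map i₁.continuous

/-- The stalks are those of the spectra of domains, so they are reduced; irreducibility holds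
because the generic point of the overlap specialises to every point of both charts. -/
theorem isIntegral (h : IsChartPair A₁ A₂ B x) (H : IsGlueOf A₁ A₂ B le₁ le₂ π i₁ i₂) :
    IsIntegral X := by
  have := H.open₁
  have := H.open₂
  have hred : IsReduced X := by
    have : ∀ x : X, _root_.IsReduced (X.presheaf.stalk x) := by
      intro x
      rcases H.cover x with ⟨y, rfl⟩ | ⟨y, rfl⟩
      · exact isReduced_of_injective _
          (asIso (i₁.stalkMap y)).commRingCatIsoToRingEquiv.injective
      · exact isReduced_of_injective _
          (asIso (i₂.stalkMap y)).commRingCatIsoToRingEquiv.injective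
    exact isReduced_of_isReduced_stalk X
  have hirr : IrreducibleSpace X := by
    let η := i₁ (specInclusion le₁ (genericPoint (Spec (CommRingCat.of B))))
    have hη : η = i₂ (specInclusion le₂ (genericPoint (Spec (CommRingCat.of B)))) :=
      congr($H.glue (genericPoint (Spec (CommRingCat.of B))))
    have : closure {η} = Set.univ := by
      refine Set.eq_univ_of_forall fun x ↦ ?_
      rw [← specializes_iff_mem_closure]
      rcases H.cover x with ⟨y, rfl⟩ | ⟨y, rfl⟩
      · exact H.genericPoint_specializes h y
      · rw [hη]
        exact H.symm.genericPoint_specializes h.symm y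
    rw [irreducibleSpace_def, Set.top_eq_univ, ← this]
    exact isIrreducible_singleton.closure
  exact isIntegral_of_irreducibleSpace_of_isReduced X

end IsGlueOf

end Glue

/-! ### Transcendence degree from the rank of the differentials -/

section TranscendenceDegree

variable {k K : Type u} [Field k] [Field K] [Algebra k K]

open scoped IntermediateField.algebraAdjoinAdjoin in
/-- Algebraically independent elements over which a field is separable define a formally étale
algebra over the polynomial ring. -/
theorem formallyEtale_aeval_of_isSeparable {ι : Type u} {v : ι → K}
    (hv : AlgebraicIndependent k v)
    [Algebra.IsSeparable (IntermediateField.adjoin k (Set.range v)) K] :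
    letI : Algebra (MvPolynomial ι k) K := (MvPolynomial.aeval v).toRingHom.toAlgebra
    Algebra.FormallyEtale (MvPolynomial ι k) K := by
  let : Algebra (MvPolynomial ι k) K := (MvPolynomial.aeval v).toRingHom.toAlgebra
  let : Algebra (MvPolynomial ι k) (Algebra.adjoin k (Set.range v)) :=
    hv.aevalEquiv.toRingEquiv.toRingHom.toAlgebra
  have : IsScalarTower (MvPolynomial ι k) (Algebra.adjoin k (Set.range v)) K :=
    IsScalarTower.of_algebraMap_eq fun p ↦ (hv.algebraMap_aevalEquiv p).symm
  have : Algebra.FormallyEtale (MvPolynomial ι k) (Algebra.adjoin k (Set.range v)) :=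
    .of_equiv (A := MvPolynomial ι k)
      { hv.aevalEquiv.toRingEquiv with commutes' := fun _ ↦ rfl }
  have : Algebra.FormallyEtale (Algebra.adjoin k (Set.range v))
      (IntermediateField.adjoin k (Set.range v)) := .of_isLocalization (nonZeroDivisors _)
  have : Algebra.FormallyEtale (IntermediateField.adjoin k (Set.range v)) K :=
    Algebra.FormallyEtale.of_isSeparable _ K
  have : Algebra.FormallyEtale (Algebra.adjoin k (Set.range v)) K :=
    .comp _ (IntermediateField.adjoin k (Set.range v)) _
  exact .comp _ (Algebra.adjoin k (Set.range v)) _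

theorem rank_kaehlerDifferential_of_isSeparable {ι : Type u} {v : ι → K}
    (hv : AlgebraicIndependent k v)
    [Algebra.IsSeparable (IntermediateField.adjoin k (Set.range v)) K] :
    Module.rank K Ω[K⁄k] = Cardinal.mk ι := by
  let : Algebra (MvPolynomial ι k) K := (MvPolynomial.aeval v).toRingHom.toAlgebra
  have : IsScalarTower k (MvPolynomial ι k) K :=
    IsScalarTower.of_algebraMap_eq fun r ↦ (AlgHom.commutes _ r).symm
  have : Algebra.FormallyEtale (MvPolynomial ι k) K := formallyEtale_aeval_of_isSeparable hv
  have e := KaehlerDifferential.tensorKaehlerEquivOfFormallyEtale k (MvPolynomial ι k) K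
  exact (((KaehlerDifferential.mvPolynomialBasis k ι).baseChange K).map e).mk_eq_rank''.symm

/-- In characteristic zero there is a separating transcendence basis, and its cardinality is the
rank of the differentials. So the transcendence degree is one and any transcendental element is a
transcendence basis. -/
theorem exists_transcendental_of_rank_kaehlerDifferential [CharZero k] [Algebra.EssFiniteType k K]
    (h : Module.rank K Ω[K⁄k] = 1) : (∃ t : K, Transcendental k t) ∧
      ∀ t : K, Transcendental k t → Algebra.IsAlgebraic (IntermediateField.adjoin k {t}) K := by
  obtain ⟨s, hs, hsep⟩ := exists_isTranscendenceBasis_and_isSeparable_of_perfectField k K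
  have : Algebra.IsSeparable (IntermediateField.adjoin k (Set.range ((↑) : s → K))) K := by
    convert! hsep <;> simp
  have hc : Cardinal.mk s = 1 := by
    rwa [rank_kaehlerDifferential_of_isSeparable hs.1] at h
  have htr : Algebra.trdeg k K = 1 := by
    rw [← hs.cardinalMk_eq_trdeg, hc]
  refine ⟨?_, fun t ht ↦ ?_⟩
  · obtain ⟨⟨t, hts⟩⟩ := Cardinal.mk_ne_zero_iff.1 (hc.trans_ne one_ne_zero)
    exact ⟨t, hs.1.transcendental ⟨t, hts⟩⟩
  · have hi : AlgebraicIndependent k (fun _ : Unit ↦ t) :=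
      algebraicIndependent_unique_type_iff.2 ht
    have hb := hi.isTranscendenceBasis_of_lift_trdeg_le_of_finite (by simp [htr])
    have := hb.isAlgebraic_field
    rwa [Set.range_const] at this

end TranscendenceDegree

/-! ### Local rings with residue field `k` and cyclic differentials are valuation rings -/

section ValuationRing

open IsLocalRing

variable {k O : Type*} [Field k] [CommRing O] [IsLocalRing O] [Algebra k O]

/-- The derivation `O → 𝔪/𝔪²` of a local `k`-algebra with residue field `k`: it maps `c + m`, with
`c` in `k` and `m` in `𝔪`, to the class of `m`. -/
theorem exists_derivation_cotangentSpace
    (hres : ∀ a : O, ∃ c : k, a - algebraMap k O c ∈ maximalIdeal O) :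
    ∃ D : Derivation k O (CotangentSpace O), ∀ m : maximalIdeal O,
      D m = (maximalIdeal O).toCotangent m := by
  -- `r` is the residue map to `k`. Uniqueness of the residue makes it additive, multiplicative and
  -- the identity on constants.
  choose r hr using hres
  have huniq : ∀ c d : k, algebraMap k O c - algebraMap k O d ∈ maximalIdeal O → c = d := by
    intro c d h
    by_contra hcd
    rw [← map_sub, mem_maximalIdeal] at h
    exact h ((IsUnit.mk0 _ (sub_ne_zero.2 hcd)).map (algebraMap k O))
  have hr' : ∀ (a : O) (c : k), a - algebraMap k O c ∈ maximalIdeal O → r a = c := by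
    intro a c h
    apply huniq
    have := sub_mem h (hr a)
    rwa [sub_sub_sub_cancel_left] at this
  have hadd (a b : O) : r (a + b) = r a + r b := hr' _ _ (by
    rw [map_add, add_sub_add_comm]
    exact add_mem (hr a) (hr b))
  have hmul (a b : O) : r (a * b) = r a * r b := hr' _ _ (by
    have : a * b - algebraMap k O (r a * r b) = a * (b - algebraMap k O (r b)) +
        algebraMap k O (r b) * (a - algebraMap k O (r a)) := by
      rw [map_mul]; ring
    rw [this]
    exact add_mem (Ideal.mul_mem_left _ _ (hr b)) (Ideal.mul_mem_left _ _ (hr a)))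
  have halg (c : k) : r (algebraMap k O c) = c := hr' _ _ (by simp)
  have hsq {a b : O} (ha : a ∈ maximalIdeal O) (m : maximalIdeal O) :
      (maximalIdeal O).toCotangent (a • m) = 0 := by
    rw [Ideal.toCotangent_eq_zero, pow_two]
    exact Ideal.mul_mem_mul ha m.2
  let L : O →ₗ[k] CotangentSpace O :=
    { toFun a := (maximalIdeal O).toCotangent ⟨_, hr a⟩
      map_add' a b := by
        rw [← map_add]
        congr 1
        ext
        simp only [hadd, map_add, Submodule.coe_add]
        ring
      map_smul' c a := by
        refine Eq.trans ?_ (algebraMap_smul O c ((maximalIdeal O).toCotangent ⟨_, hr a⟩))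
        rw [← map_smul]
        congr 1
        ext
        simp only [Algebra.smul_def, hmul, halg, map_mul, Submodule.coe_smul,
          Algebra.algebraMap_self, RingHom.id_apply]
        ring }
  refine ⟨Derivation.mk' L fun a b ↦ ?_, fun m ↦ ?_⟩
  · change (maximalIdeal O).toCotangent _ = a • (maximalIdeal O).toCotangent _ +
      b • (maximalIdeal O).toCotangent _
    -- The maximal ideal kills the cotangent space, so `b` acts through its residue. The Leibniz
    -- rule becomes the identity `ab - r(a)r(b) = a(b - r(b)) + r(b)(a - r(a))`.
    have h1 : b • (maximalIdeal O).toCotangent ⟨_, hr a⟩ =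
        algebraMap k O (r b) • (maximalIdeal O).toCotangent ⟨_, hr a⟩ := by
      rw [← sub_eq_zero, ← sub_smul, ← map_smul]
      exact hsq (a := b - _) (b := b) (hr b) _
    rw [h1, ← map_smul, ← map_smul, ← map_add]
    congr 1
    ext
    simp only [hmul, map_mul, Submodule.coe_smul, smul_eq_mul, Submodule.coe_add]
    ring
  · change (maximalIdeal O).toCotangent _ = _
    congr 1
    ext
    have : r (m : O) = 0 := hr' _ _ (by simp)
    simp [this]

/-- The derivation `O → 𝔪/𝔪²` induces a surjection from the differentials, so the cotangent space
has dimension at most one. For a Noetherian local domain this forces a valuation ring. -/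
theorem valuationRing_of_span_kaehlerDifferential [IsDomain O] [IsNoetherianRing O]
    (hres : ∀ a : O, ∃ c : k, a - algebraMap k O c ∈ maximalIdeal O)
    (hΩ : ∃ ω : Ω[O⁄k], Submodule.span O {ω} = ⊤) : ValuationRing O := by
  obtain ⟨D, hD⟩ := exists_derivation_cotangentSpace hres
  obtain ⟨ω, hω⟩ := hΩ
  refine ((tfae_of_isNoetherianRing_of_isLocalRing_of_isDomain O).out 1 5).2 ?_
  refine finrank_le_one (D.liftKaehlerDifferential ω) fun w ↦ ?_
  obtain ⟨m, rfl⟩ := (maximalIdeal O).toCotangent_surjective w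
  obtain ⟨f, hf⟩ := Submodule.mem_span_singleton.1
    (hω ▸ Submodule.mem_top : KaehlerDifferential.D k O m ∈ Submodule.span O {ω})
  refine ⟨residue O f, ?_⟩
  rw [← hD, ← Derivation.liftKaehlerDifferential_comp_D, ← hf, map_smul]
  rfl

end ValuationRing

/-! ### Differentials of étale algebras over a smooth chart -/

section Differentials

variable {k S T : Type u} [Field k] [CommRing S] [CommRing T] [Algebra k S] [Algebra k T]
  [Algebra S T] [IsScalarTower k S T]

theorem exists_basis_kaehlerDifferential_of_formallyEtale [Nontrivial S]
    [Algebra.IsStandardSmoothOfRelativeDimension 1 k S] [Algebra.FormallyEtale S T] :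
    Nonempty (Module.Basis Unit T Ω[T⁄k]) := by
  have : Algebra.IsStandardSmooth k S :=
    Algebra.IsStandardSmoothOfRelativeDimension.isStandardSmooth 1
  have hr : Module.rank S Ω[S⁄k] = 1 := by
    exact_mod_cast Algebra.IsStandardSmoothOfRelativeDimension.rank_kaehlerDifferential
      (R := k) (S := S) 1
  let b : Module.Basis Unit S Ω[S⁄k] :=
    Module.basisUnique Unit (Module.rank_eq_one_iff_finrank_eq_one.1 hr)
  exact ⟨(b.baseChange T).map
    (KaehlerDifferential.tensorKaehlerEquivOfFormallyEtale k S T)⟩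

end Differentials

/-! ### Local rings, centres of valuations and rational points of a curve -/

namespace SmoothProperCurve

variable {k : Type u} [Field k] (C : SmoothProperCurve k)

/-- The constants, as sections of the structure sheaf over an open subset. -/
noncomputable def toSections (V : C.X.Opens) : k →+* Γ(C.X, V) :=
  ((Scheme.ΓSpecIso (CommRingCat.of k)).inv ≫ C.π.appLE ⊤ V le_top).hom

/-- The constants, as elements of the local ring at a point. -/
noncomputable def toStalk (x : C.X) : k →+* C.X.presheaf.stalk x :=
  ((Scheme.ΓSpecIso (CommRingCat.of k)).inv ≫ C.π.appTop ≫
    C.X.presheaf.germ ⊤ x (TopologicalSpace.Opens.mem_top _)).hom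

theorem germ_comp_toSections {V : C.X.Opens} {x : C.X} (hx : x ∈ V) :
    (C.X.presheaf.germ V x hx).hom.comp (C.toSections V) = C.toStalk x := by
  rw [toSections, toStalk, ← CommRingCat.hom_comp, Category.assoc]
  congr 2
  have : C.π.appLE ⊤ V le_top =
      C.π.appTop ≫ C.X.presheaf.map (homOfLE (show V ≤ ⊤ from le_top)).op := rfl
  rw [this, Category.assoc, TopCat.Presheaf.germ_res]

theorem algebraMap_comp_toStalk (x : C.X) :
    (algebraMap (C.X.presheaf.stalk x) C.FunctionField).comp (C.toStalk x) =
      algebraMap k C.FunctionField := by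
  refine congr_arg CommRingCat.Hom.hom (?_ : _ ≫ C.X.presheaf.stalkSpecializes
    ((genericPoint_spec C.X).specializes trivial) = _)
  rw [Category.assoc, Category.assoc, TopCat.Presheaf.germ_stalkSpecializes]

theorem fromSpecStalk_comp_π (x : C.X) :
    C.X.fromSpecStalk x ≫ C.π = Spec.map (CommRingCat.ofHom (C.toStalk x)) := by
  have h := Scheme.toSpecΓ_naturality C.π
  rw [← SpecMap_ΓSpecIso_hom (CommRingCat.of k)] at h
  rw [← cancel_mono (Spec.map (Scheme.ΓSpecIso (CommRingCat.of k)).hom), Category.assoc, h,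
    ← Category.assoc, Scheme.fromSpecStalk_toSpecΓ, ← Spec.map_comp, ← Spec.map_comp]
  congr 1
  rw [toStalk, CommRingCat.ofHom_hom, Iso.hom_inv_id_assoc]

theorem exists_affine_chart (x : C.X) : ∃ V : C.X.Opens, IsAffineOpen V ∧ x ∈ V ∧
    (C.toSections V).IsStandardSmoothOfRelativeDimension 1 := by
  have := C.smooth
  obtain ⟨U, hU, V, hV, hx, e, hs⟩ :=
    SmoothOfRelativeDimension.exists_isStandardSmoothOfRelativeDimension (n := 1) (f := C.π) x
  -- The spectrum of a field has a single point.
  obtain rfl : U = ⊤ := by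
    have hs : Subsingleton (Spec (CommRingCat.of k)) :=
      inferInstanceAs (Subsingleton (PrimeSpectrum k))
    rw [eq_top_iff]
    intro y _
    rw [Subsingleton.elim y (C.π x)]
    exact e hx
  refine ⟨V, hV, hx, ?_⟩
  rw [toSections, CommRingCat.hom_comp]
  exact RingHom.isStandardSmoothOfRelativeDimension_respectsIso.2 _
    (Scheme.ΓSpecIso (CommRingCat.of k)).symm.commRingCatIsoToRingEquiv hs

/-- The local ring at a point of the curve is essentially of finite type, and its module of
differentials is free of rank one. -/
theorem essFiniteType_and_exists_basis_kaehlerDifferential (x : C.X) :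
    let := (C.toStalk x).toAlgebra
    Algebra.EssFiniteType k (C.X.presheaf.stalk x) ∧
      Nonempty (Module.Basis Unit (C.X.presheaf.stalk x) Ω[C.X.presheaf.stalk x⁄k]) := by
  intro
  obtain ⟨V, hV, hx, hs⟩ := C.exists_affine_chart x
  let := (C.toSections V).toAlgebra
  let : Algebra Γ(C.X, V) (C.X.presheaf.stalk x) := (C.X.presheaf.germ V x hx).hom.toAlgebra
  have : IsScalarTower k Γ(C.X, V) (C.X.presheaf.stalk x) :=
    .of_algebraMap_eq' (C.germ_comp_toSections hx).symm
  have : Algebra.IsStandardSmoothOfRelativeDimension 1 k Γ(C.X, V) := hs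
  have : Algebra.IsStandardSmooth k Γ(C.X, V) :=
    Algebra.IsStandardSmoothOfRelativeDimension.isStandardSmooth 1
  have hl : IsLocalization.AtPrime (C.X.presheaf.stalk x) (hV.primeIdealOf ⟨x, hx⟩).asIdeal :=
    hV.isLocalization_stalk ⟨x, hx⟩
  have : Nontrivial Γ(C.X, V) := (C.X.presheaf.germ V x hx).hom.domain_nontrivial
  have : Algebra.FormallyEtale Γ(C.X, V) (C.X.presheaf.stalk x) :=
    .of_isLocalization (hV.primeIdealOf ⟨x, hx⟩).asIdeal.primeCompl
  have : Algebra.EssFiniteType Γ(C.X, V) (C.X.presheaf.stalk x) :=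
    .of_isLocalization _ (hV.primeIdealOf ⟨x, hx⟩).asIdeal.primeCompl
  exact ⟨.comp _ Γ(C.X, V) _, exists_basis_kaehlerDifferential_of_formallyEtale (S := Γ(C.X, V))⟩

theorem exists_transcendental [CharZero k] : (∃ t : C.FunctionField, Transcendental k t) ∧
    ∀ t : C.FunctionField, Transcendental k t →
      Algebra.IsAlgebraic (IntermediateField.adjoin k {t}) C.FunctionField := by
  obtain ⟨h₁, ⟨b⟩⟩ := C.essFiniteType_and_exists_basis_kaehlerDifferential (genericPoint C.X)
  have : Algebra.EssFiniteType k C.FunctionField := h₁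
  apply exists_transcendental_of_rank_kaehlerDifferential
  let b' : Module.Basis Unit C.FunctionField Ω[C.FunctionField⁄k] := b
  simpa using rank_eq_card_basis b'

/-- For a morphism `Spec R ⟶ X` that is the generic point on the function field, the local
homomorphism from the stalk at the centre is compatible with the embeddings into the function field,
since `fromSpecStalk` is a monomorphism. -/
theorem algebraMap_comp_stalkClosedPointTo {R : Type u} [CommRing R] [IsLocalRing R]
    (i : R →+* C.FunctionField) (f : Spec (CommRingCat.of R) ⟶ C.X)
    (h : Spec.map (CommRingCat.ofHom i) ≫ f = C.X.fromSpecStalk (genericPoint C.X)) :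
    i.comp (Scheme.stalkClosedPointTo f).hom =
      algebraMap (C.X.presheaf.stalk (f (IsLocalRing.closedPoint R))) C.FunctionField := by
  have hs : genericPoint C.X ⤳ f (IsLocalRing.closedPoint R) :=
    (genericPoint_spec C.X).specializes trivial
  have h' := h
  rw [← Scheme.SpecMap_stalkSpecializes_fromSpecStalk hs] at h'
  have h'' := Scheme.Spec_stalkClosedPointTo_fromSpecStalk f
  have h3 : Spec.map (CommRingCat.ofHom i) ≫ Spec.map (Scheme.stalkClosedPointTo f) ≫
      C.X.fromSpecStalk _ = Spec.map (C.X.presheaf.stalkSpecializes hs) ≫ C.X.fromSpecStalk _ := by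
    rw [h'', h']
  rw [← Category.assoc, cancel_mono, ← Spec.map_comp] at h3
  exact congr_arg CommRingCat.Hom.hom (Spec.map_injective h3)

theorem stalkClosedPointTo_comp_toStalk {R : Type u} [CommRing R] [IsLocalRing R] [Algebra k R]
    (f : Spec (CommRingCat.of R) ⟶ C.X)
    (h : f ≫ C.π = Spec.map (CommRingCat.ofHom (algebraMap k R))) :
    (Scheme.stalkClosedPointTo f).hom.comp (C.toStalk _) = algebraMap k R := by
  have h' := Scheme.Spec_stalkClosedPointTo_fromSpecStalk f
  rw [← h', Category.assoc, C.fromSpecStalk_comp_π, ← Spec.map_comp] at h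
  exact congr_arg CommRingCat.Hom.hom (Spec.map_injective h)

/-- The valuative criterion of properness: a valuation subring of the function field that contains
the constants has a centre on the curve. -/
theorem exists_spec_hom (W : ValuationSubring C.FunctionField)
    (hW : ∀ c : k, algebraMap k C.FunctionField c ∈ W) :
    ∃ f : Spec (CommRingCat.of W) ⟶ C.X,
      f ≫ C.π = Spec.map (CommRingCat.ofHom ((algebraMap k C.FunctionField).codRestrict W hW)) ∧
      Spec.map (CommRingCat.ofHom W.subtype) ≫ f =
        C.X.fromSpecStalk (genericPoint C.X) := by
  have := C.isProper
  have h := (show ValuativeCriterion C.π from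
    ((congr_fun (congr_fun (congr_fun IsProper.eq_valuativeCriterion _) _) C.π).mp
      this).1.1.1).existence
  let S : ValuativeCommSq C.π :=
    { R := W
      K := C.FunctionField
      i₁ := C.X.fromSpecStalk (genericPoint C.X)
      i₂ := Spec.map (CommRingCat.ofHom ((algebraMap k C.FunctionField).codRestrict W hW))
      commSq := ⟨by
        rw [C.fromSpecStalk_comp_π, ← Spec.map_comp]
        rfl⟩ }
  obtain ⟨⟨l⟩⟩ := h S
  exact ⟨l.l, l.fac_right, l.fac_left⟩

theorem exists_retraction {R : Type*} [CommRing R] [IsLocalRing R] [Algebra k R]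
    (h : ∀ a : R, ∃ c : k, a - algebraMap k R c ∈ IsLocalRing.maximalIdeal R) :
    ∃ ρ : R →+* k, ρ.comp (algebraMap k R) = .id k := by
  have hb : Function.Bijective (algebraMap k (IsLocalRing.ResidueField R)) := by
    refine ⟨(algebraMap k _).injective, fun r ↦ ?_⟩
    obtain ⟨a, rfl⟩ := IsLocalRing.residue_surjective r
    obtain ⟨c, hc⟩ := h a
    refine ⟨c, ?_⟩
    rw [← IsLocalRing.residue_eq_zero_iff, map_sub, sub_eq_zero] at hc
    exact hc.symm
  refine ⟨(RingEquiv.ofBijective _ hb).symm.toRingHom.comp (IsLocalRing.residue R), ?_⟩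
  ext c
  exact (RingEquiv.ofBijective _ hb).symm_apply_apply c

/-- Two retractions of a local algebra onto its base field agree. -/
theorem retraction_ext {R : Type*} [CommRing R] [IsLocalRing R] [Algebra k R]
    {ρ ρ' : R →+* k} (h : ρ.comp (algebraMap k R) = .id k)
    (h' : ρ'.comp (algebraMap k R) = .id k) : ρ = ρ' := by
  ext a
  have hc (c : k) : ρ (algebraMap k R c) = c := RingHom.congr_fun h c
  have hc' (c : k) : ρ' (algebraMap k R c) = c := RingHom.congr_fun h' c
  have h1 : ¬ IsUnit (a - algebraMap k R (ρ a)) := fun hu ↦ by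
    have := hu.map ρ
    rw [map_sub, hc, sub_self] at this
    exact not_isUnit_zero this
  have h2 : a - algebraMap k R (ρ' a) ∈ IsLocalRing.maximalIdeal R := by
    rw [IsLocalRing.mem_maximalIdeal]
    intro hu
    have := hu.map ρ'
    rw [map_sub, hc', sub_self] at this
    exact not_isUnit_zero this
  by_contra hne
  have h3 := sub_mem h2 ((IsLocalRing.mem_maximalIdeal _).2 h1)
  rw [sub_sub_sub_cancel_left, ← map_sub] at h3
  exact h3 (((sub_ne_zero.2 hne).isUnit).map _)

theorem algebraMap_mem_localRing (x : C.X) (c : k) :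
    algebraMap k C.FunctionField c ∈ C.localRing x :=
  ⟨C.toStalk x c, RingHom.congr_fun (C.algebraMap_comp_toStalk x) c⟩

variable {C} in
theorem RationalPoint.exists_sub_mem_maximalIdeal (p : C.RationalPoint)
    (a : C.X.presheaf.stalk p.pt) : ∃ c : k, a - C.toStalk p.pt c ∈ IsLocalRing.maximalIdeal _ := by
  have h := C.stalkClosedPointTo_comp_toStalk (R := k) p.1 (p.2.trans (Spec.map_id _).symm)
  let φ : C.X.presheaf.stalk p.pt →+* k := (Scheme.stalkClosedPointTo p.1).hom
  have hφ (c : k) : φ (C.toStalk p.pt c) = c := RingHom.congr_fun h c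
  refine ⟨φ a, fun hu ↦ ?_⟩
  have := hu.map φ
  rw [map_sub, hφ, sub_self] at this
  exact not_isUnit_zero this

variable {C} in
/-- The local ring at a rational point is a proper subring of the function field. -/
theorem RationalPoint.localRing_ne_top [CharZero k] (p : C.RationalPoint) :
    C.localRing p.pt ≠ ⊤ := by
  intro h
  obtain ⟨t, ht⟩ := C.exists_transcendental.1
  refine ht ?_
  obtain ⟨a, rfl⟩ : t ∈ C.localRing p.pt := h ▸ trivial
  obtain ⟨c, hc⟩ := p.exists_sub_mem_maximalIdeal a
  -- If the local ring were the whole field, the nonunit `a - c` would have to vanish, and `t` would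
  -- be a constant.
  have : a = C.toStalk p.pt c := by
    by_contra hne
    have h0 := sub_ne_zero.2 hne
    have h1 : algebraMap _ C.FunctionField (a - C.toStalk p.pt c) ≠ 0 := by
      rwa [Ne, FaithfulSMul.algebraMap_eq_zero_iff]
    obtain ⟨b, hb⟩ : (algebraMap _ C.FunctionField (a - C.toStalk p.pt c))⁻¹ ∈ C.localRing p.pt :=
      h ▸ trivial
    refine hc (.of_mul_eq_one b ?_)
    apply IsFractionRing.injective (C.X.presheaf.stalk p.pt) C.FunctionField
    rw [map_mul, hb, mul_inv_cancel₀ h1, map_one]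
  rw [this]
  have := RingHom.congr_fun (C.algebraMap_comp_toStalk p.pt) c
  exact this ▸ isAlgebraic_algebraMap c

/-- Valuation rings are maximal for domination. The stalk is dominated by `W`, and it is itself a
valuation ring because its residue field is `k` and its differentials are free of rank one. -/
theorem localRing_eq_of_isLocalHom {x : C.X} (W : ValuationSubring C.FunctionField)
    (φ : C.X.presheaf.stalk x →+* W) [IsLocalHom φ]
    (hφ : W.subtype.comp φ = algebraMap (C.X.presheaf.stalk x) C.FunctionField)
    (hres : ∀ a, ∃ c : k, φ a - φ (C.toStalk x c) ∈ IsLocalRing.maximalIdeal W) :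
    C.localRing x = W.toSubring := by
  obtain ⟨h₁, ⟨b⟩⟩ := C.essFiniteType_and_exists_basis_kaehlerDifferential x
  let := (C.toStalk x).toAlgebra
  have : IsNoetherianRing (C.X.presheaf.stalk x) := Algebra.EssFiniteType.isNoetherianRing k _
  have : ValuationRing (C.X.presheaf.stalk x) := by
    refine valuationRing_of_span_kaehlerDifferential (k := k) (fun a ↦ ?_) ⟨b (), ?_⟩
    · obtain ⟨c, hc⟩ := hres a
      rw [← map_sub] at hc
      exact ⟨c, fun hu ↦ hc (hu.map φ)⟩
    · rw [← b.span_eq, Set.range_unique]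
  refine le_antisymm ?_ fun w hw ↦ ?_
  · rintro _ ⟨a, rfl⟩
    rw [← hφ]
    exact (φ a).2
  · obtain ⟨a, ha⟩ | ⟨a, ha⟩ :=
      ValuationRing.isInteger_or_isInteger (C.X.presheaf.stalk x) w
    · exact ⟨a, ha⟩
    by_cases h0 : w = 0
    · exact h0 ▸ zero_mem _
    have hu : IsUnit (φ a) := by
      refine .of_mul_eq_one ⟨w, hw⟩ (Subtype.ext ?_)
      have : (φ a : C.FunctionField) = w⁻¹ := (RingHom.congr_fun hφ a).trans ha
      exact (congr_arg (· * w) this).trans (inv_mul_cancel₀ h0)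
    obtain ⟨u, rfl⟩ := isUnit_of_map_unit φ a hu
    refine ⟨(u⁻¹ : (C.X.presheaf.stalk x)ˣ), ?_⟩
    rw [← inv_inv w, ← ha]
    exact eq_inv_of_mul_eq_one_left (by rw [← map_mul, u.inv_mul, map_one])

/-- A valuation subring of the function field that contains the constants and has residue field
`k` is the local ring at a rational
point. -/
theorem exists_rationalPoint (W : ValuationSubring C.FunctionField)
    (hW : ∀ c : k, algebraMap k C.FunctionField c ∈ W)
    (hres : ∀ a ∈ W, ∃ c : k, a - algebraMap k C.FunctionField c = 0 ∨
      (a - algebraMap k C.FunctionField c)⁻¹ ∉ W) :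
    ∃ p : C.RationalPoint, C.localRing p.pt = W.toSubring := by
  obtain ⟨f, hfπ, hf⟩ := C.exists_spec_hom W hW
  let : Algebra k W := ((algebraMap k C.FunctionField).codRestrict W hW).toAlgebra
  have hres' : ∀ a : W, ∃ c : k, a - algebraMap k W c ∈ IsLocalRing.maximalIdeal W := by
    intro a
    obtain ⟨c, hc⟩ := hres a a.2
    refine ⟨c, fun hu ↦ ?_⟩
    obtain ⟨u, hu⟩ := hu
    have hu' : (u : W) = (a : C.FunctionField) - algebraMap k C.FunctionField c :=
      congr_arg Subtype.val hu
    rcases hc with hc | hc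
    · rw [← hu'] at hc
      exact u.ne_zero (Subtype.ext hc)
    · apply hc
      rw [← hu', inv_eq_of_mul_eq_one_right (b := ((u⁻¹ : Wˣ) : W).1)]
      · exact ((u⁻¹ : Wˣ) : W).2
      · exact congr_arg Subtype.val u.mul_inv
  have h₁ := C.algebraMap_comp_stalkClosedPointTo W.subtype f hf
  have h₂ := C.stalkClosedPointTo_comp_toStalk f hfπ
  have hloc := Scheme.isLocalHom_stalkClosedPointTo f
  obtain ⟨ρ, hρ⟩ := exists_retraction hres'
  have hρm : ∀ a, ¬ IsUnit a → ρ a = 0 := by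
    intro a ha
    by_contra h0
    have h3 : ¬ IsUnit (a - algebraMap k W (ρ a)) := fun hu ↦ by
      have := hu.map ρ
      rw [map_sub, show ρ (algebraMap k W (ρ a)) = ρ a from RingHom.congr_fun hρ _,
        sub_self] at this
      exact not_isUnit_zero this
    have h4 :=
      sub_mem ((IsLocalRing.mem_maximalIdeal _).2 ha) ((IsLocalRing.mem_maximalIdeal _).2 h3)
    rw [sub_sub_cancel] at h4
    exact h4 ((IsUnit.mk0 _ h0).map _)
  have hρloc : IsLocalHom ρ := ⟨fun a ha ↦ by
    by_contra h
    rw [hρm a h] at ha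
    exact not_isUnit_zero ha⟩
  -- The rational point is the centre of `W`, given a `k`-structure by the retraction `ρ` of `W`
  -- onto its residue field `k`.
  let p : C.RationalPoint := ⟨Spec.map (CommRingCat.ofHom ρ) ≫ f, by
    rw [Category.assoc, hfπ, ← Spec.map_comp, ← CommRingCat.ofHom_comp]
    exact (congr_arg (fun g ↦ Spec.map (CommRingCat.ofHom g)) hρ).trans (Spec.map_id _)⟩
  have hp : p.pt = f (IsLocalRing.closedPoint W) := by
    change f (PrimeSpectrum.comap ρ (IsLocalRing.closedPoint k)) = _
    rw [IsLocalRing.comap_closedPoint]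
  refine ⟨p, ?_⟩
  rw [hp]
  exact C.localRing_eq_of_isLocalHom W (Scheme.stalkClosedPointTo f).hom h₁ fun a ↦ by
    obtain ⟨c, hc⟩ := hres' ((Scheme.stalkClosedPointTo f).hom a)
    exact ⟨c, by rwa [← RingHom.congr_fun h₂ c] at hc⟩

theorem exists_ringEquiv_localRing (x : C.X) :
    ∃ e : C.X.presheaf.stalk x ≃+* C.localRing x, ∀ a, (e a : C.FunctionField) = algebraMap _ _ a :=
  ⟨.ofBijective (algebraMap (C.X.presheaf.stalk x) C.FunctionField).rangeRestrict
    ⟨fun _ _ h ↦ IsFractionRing.injective (C.X.presheaf.stalk x) C.FunctionField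
      (congr_arg Subtype.val h), RingHom.rangeRestrict_surjective _⟩, fun _ ↦ rfl⟩

variable {C} in
-- A rational point factors through the spectrum of its local ring. The ring is a variable `W`, so
-- that two points with equal local rings can be factored through the same scheme.
theorem RationalPoint.exists_factorization (q : C.RationalPoint) (W : Subring C.FunctionField)
    (h : C.localRing q.pt = W) (hW : ∀ c : k, algebraMap k C.FunctionField c ∈ W) :
    ∃ (f : Spec (CommRingCat.of W) ⟶ C.X) (ρ : W →+* k),
      q.1 = Spec.map (CommRingCat.ofHom ρ) ≫ f ∧
      ρ.comp ((algebraMap k C.FunctionField).codRestrict W hW) = .id k ∧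
      f ≫ C.π = Spec.map (CommRingCat.ofHom ((algebraMap k C.FunctionField).codRestrict W hW)) ∧
      Spec.map (CommRingCat.ofHom W.subtype) ≫ f = C.X.fromSpecStalk (genericPoint C.X) := by
  subst h
  obtain ⟨e, he⟩ := C.exists_ringEquiv_localRing q.pt
  have hφ := C.stalkClosedPointTo_comp_toStalk (R := k) q.1 (q.2.trans (Spec.map_id _).symm)
  let φ : C.X.presheaf.stalk q.pt →+* k := (Scheme.stalkClosedPointTo q.1).hom
  have hec : e.toRingHom.comp (C.toStalk q.pt) =
      (algebraMap k C.FunctionField).codRestrict (C.localRing q.pt) hW := by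
    ext c
    exact (he _).trans (RingHom.congr_fun (C.algebraMap_comp_toStalk q.pt) c)
  refine ⟨Spec.map (CommRingCat.ofHom e.toRingHom) ≫ C.X.fromSpecStalk q.pt,
    φ.comp e.symm.toRingHom, ?_, ?_, ?_, ?_⟩
  · rw [← Category.assoc, ← Spec.map_comp, ← CommRingCat.ofHom_comp, RingHom.comp_assoc]
    refine (Scheme.Spec_stalkClosedPointTo_fromSpecStalk q.1).symm.trans ?_
    refine congr_arg (fun g ↦ Spec.map (CommRingCat.ofHom g) ≫ C.X.fromSpecStalk q.pt)
      (?_ : φ = _)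
    ext a
    exact congr_arg φ (e.symm_apply_apply a).symm
  · rw [← hec]
    refine Eq.trans ?_ hφ
    ext c
    exact congr_arg φ (e.symm_apply_apply _)
  · rw [Category.assoc, C.fromSpecStalk_comp_π, ← Spec.map_comp, ← CommRingCat.ofHom_comp, hec]
  · rw [← Category.assoc, ← Spec.map_comp, ← CommRingCat.ofHom_comp]
    refine Eq.trans ?_ (Scheme.SpecMap_stalkSpecializes_fromSpecStalk
      ((genericPoint_spec C.X).specializes (trivial : q.pt ∈ _)))
    congr 2
    ext a
    exact he a

theorem isDominant_specMap_of_injective {R S : Type u} [CommRing R] [CommRing S]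
    (f : R →+* S) (hf : Function.Injective f) :
    IsDominant (Spec.map (CommRingCat.ofHom f)) := by
  refine ⟨(PrimeSpectrum.denseRange_comap_iff_ker_le_nilRadical f).2 ?_⟩
  rw [(RingHom.injective_iff_ker_eq_bot f).1 hf]
  exact bot_le

variable {C} in
/-- A rational point is determined by its local ring. -/
theorem RationalPoint.ext_localRing {p q : C.RationalPoint}
    (h : C.localRing p.pt = C.localRing q.pt) : p = q := by
  obtain ⟨f, ρ, h₁, h₂, h₃, h₄⟩ := p.exists_factorization _ rfl (C.algebraMap_mem_localRing _)
  obtain ⟨f', ρ', h₁', h₂', h₃', h₄'⟩ :=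
    q.exists_factorization _ h.symm (C.algebraMap_mem_localRing _)
  obtain ⟨e, -⟩ := C.exists_ringEquiv_localRing p.pt
  have := e.isLocalRing
  let : Algebra k (C.localRing p.pt) :=
    ((algebraMap k C.FunctionField).codRestrict _ (C.algebraMap_mem_localRing p.pt)).toAlgebra
  obtain rfl : ρ = ρ' := retraction_ext h₂ h₂'
  have := C.isProper
  have := isDominant_specMap_of_injective (C.localRing p.pt).subtype Subtype.val_injective
  -- Both morphisms restrict to the generic point, which is dominant in the spectrum of the local
  -- ring, and the curve is separated.
  obtain rfl : f = f' := ext_of_isDominant_of_isSeparated C.π (h₃.trans h₃'.symm)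
    (Spec.map (CommRingCat.ofHom (C.localRing p.pt).subtype)) (h₄.trans h₄'.symm)
  exact Subtype.ext (h₁.trans h₁'.symm)

end SmoothProperCurve

/-! ### Valuation rings stable under a Galois section -/

section Galois

open Polynomial

/-- A homomorphism to the Galois group of an algebraic extension is continuous if stabilisers of
elements are open. -/
theorem continuous_of_forall_mem_nhds {G K L : Type*} [Group G] [TopologicalSpace G]
    [IsTopologicalGroup G] [Field K] [Field L] [Algebra K L] (f : G →* Gal(L/K))
    (h : ∀ y : L, {g | f g y = y} ∈ nhds (1 : G)) : Continuous f := by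
  refine continuous_of_continuousAt_one f ?_
  rw [ContinuousAt, map_one, Filter.tendsto_def]
  intro s hs
  obtain ⟨E, hE, hEs⟩ := (krullTopology_mem_nhds_one_iff K L s).1 hs
  obtain ⟨t, rfl⟩ := IntermediateField.essFiniteType_iff.1
    (inferInstance : Algebra.EssFiniteType K E)
  have h' : (⋂ y ∈ t, {g | f g y = y}) ∈ nhds (1 : G) :=
    (Filter.biInter_finset_mem t).2 fun y _ ↦ h y
  refine Filter.mem_of_superset h' fun g hg ↦ hEs ?_
  rw [SetLike.mem_coe, IntermediateField.mem_fixingSubgroup_iff]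
  intro x hx
  have hle : IntermediateField.adjoin K (t : Set L) ≤
      IntermediateField.fixedField (Subgroup.zpowers (f g)) := by
    rw [IntermediateField.adjoin_le_iff]
    intro y hy
    have hy' : f g y = y := by simpa using Set.mem_iInter₂.1 hg y hy
    rw [SetLike.mem_coe, IntermediateField.mem_fixedField_iff]
    intro σ hσ
    have : Subgroup.zpowers (f g) ≤ MulAction.stabilizer Gal(L/K) y := by
      rwa [Subgroup.zpowers_le, MulAction.mem_stabilizer_iff]
    exact this hσ
  exact (IntermediateField.mem_fixedField_iff _ _).1 (hle hx) _ (Subgroup.mem_zpowers _)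

theorem mem_nhds_one_of_continuous {G K L : Type*} [Group G] [TopologicalSpace G]
    [Field K] [Field L] [Algebra K L] [Algebra.IsIntegral K L] (f : G →* Gal(L/K))
    (hf : Continuous f) (y : L) : {g | f g y = y} ∈ nhds (1 : G) := by
  have h := (stabilizer_isOpen_of_isIntegral (K := K) y).preimage hf
  exact h.mem_nhds (by simp)

variable {k K Ω : Type*} [Field k] [Field K] [Field Ω] [Algebra k K] [Algebra K Ω] [Algebra k Ω]
  [IsScalarTower k K Ω]

open scoped Pointwise in
theorem mem_decompositionSubgroup_iff {V : ValuationSubring Ω} {σ : Gal(Ω/K)} :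
    σ ∈ V.decompositionSubgroup K ↔ ∀ x, σ x ∈ V ↔ x ∈ V := by
  rw [ValuationSubring.decompositionSubgroup, MulAction.mem_stabilizer_iff]
  refine ⟨fun h x ↦ ?_, fun h ↦ ?_⟩
  · nth_rw 1 [← h]
    exact ValuationSubring.smul_mem_pointwise_smul_iff
  · ext x
    rw [ValuationSubring.mem_pointwise_smul_iff_inv_smul_mem, ← h]
    exact iff_of_eq (congr_arg (· ∈ V) (smul_inv_smul σ x))

theorem GaloisSection.toHom_apply_coe (s : GaloisSection k K Ω)
    (τ : Gal(algebraicClosure k Ω/k)) (c : algebraicClosure k Ω) :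
    s.toHom τ (c : Ω) = (τ c : Ω) := by
  have h := congr($(s.proj_comp) τ c)
  exact congr_arg Subtype.val h

/-- A nontrivial valuation ring that contains the constants and is stable under a Galois section. -/
structure GaloisSection.IsStablePlace (s : GaloisSection k K Ω) (V : ValuationSubring Ω) :
    Prop where
  algebraMap_mem : ∀ c : k, algebraMap k Ω c ∈ V
  ne_top : V ≠ ⊤
  apply_mem_iff : ∀ τ x, s.toHom τ x ∈ V ↔ x ∈ V

theorem ValuationSubring.mem_of_isIntegral {V : ValuationSubring Ω} (A : Subring Ω)
    (hA : A ≤ V.toSubring) {x : Ω} (hx : IsIntegral A x) : x ∈ V := by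
  have h : IsIntegral V x := by
    obtain ⟨p, hp, hpx⟩ := hx
    refine ⟨p.map (Subring.inclusion hA), hp.map _, ?_⟩
    rwa [eval₂_map]
  obtain ⟨y, rfl⟩ := IsIntegrallyClosed.isIntegral_iff.1 h
  exact y.2

theorem ValuationSubring.mem_of_isAlgebraic {V : ValuationSubring Ω} (E : Subfield Ω)
    (hE : E.toSubring ≤ V.toSubring) {x : Ω} (hx : IsAlgebraic E x) : x ∈ V :=
  V.mem_of_isIntegral E.toSubring hE hx.isIntegral

theorem ValuationSubring.algebraicClosure_mem {V : ValuationSubring Ω}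
    (hV : ∀ c : k, algebraMap k Ω c ∈ V) {x : Ω} (hx : IsAlgebraic k x) : x ∈ V := by
  refine V.mem_of_isAlgebraic (algebraMap k Ω).fieldRange ?_ (x := x) ?_
  · rintro _ ⟨c, rfl⟩
    exact hV c
  · obtain ⟨p, hp, hpx⟩ := hx
    refine ⟨p.map (algebraMap k Ω).rangeRestrictField, ?_, ?_⟩
    · exact (Polynomial.map_ne_zero_iff (RingHom.injective _)).2 hp
    · rw [aeval_def, eval₂_map]
      exact hpx

/-- If no translate of `a` by a constant is a nonunit, then the field `k(a)` is contained in the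
valuation ring. -/
theorem ValuationSubring.adjoin_le_of_inv_sub_mem [IsAlgClosed Ω] {V : ValuationSubring Ω}
    (hV : ∀ c : k, algebraMap k Ω c ∈ V) {a : Ω} (ha : a ∈ V)
    (h : ∀ c : Ω, IsAlgebraic k c → (a - c)⁻¹ ∈ V) :
    (IntermediateField.adjoin k {a}).toSubfield.toSubring ≤ V.toSubring := by
  -- `p(a)` is a constant times a product of factors `a - r` with `r` algebraic over `k`, and the
  -- hypothesis inverts each of them in `V`.
  have hinv (p : k[X]) (hp : p ≠ 0) : (aeval a p)⁻¹ ∈ V := by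
    have hp' : p.map (algebraMap k Ω) ≠ 0 := (Polynomial.map_ne_zero_iff (RingHom.injective _)).2 hp
    have hs := (IsAlgClosed.splits (p.map (algebraMap k Ω))).eq_prod_roots
    have he : aeval a p = algebraMap k Ω p.leadingCoeff *
        ((p.map (algebraMap k Ω)).roots.map fun r ↦ a - r).prod := by
      rw [aeval_def, ← Polynomial.eval_map]
      nth_rw 1 [hs]
      rw [eval_mul, eval_C, leadingCoeff_map, eval_multiset_prod, Multiset.map_map]
      simp
    rw [he, mul_inv, ← map_inv₀, ← Multiset.prod_map_inv]
    refine V.mul_mem _ _ (hV _) (multiset_prod_mem _ fun y hy ↦ ?_)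
    obtain ⟨r, hr, rfl⟩ := Multiset.mem_map.1 hy
    refine h r ⟨p, hp, ?_⟩
    rw [mem_roots hp', IsRoot, Polynomial.eval_map] at hr
    exact hr
  have hmem (p : k[X]) : aeval a p ∈ V := by
    rw [aeval_eq_sum_range]
    refine sum_mem fun i _ ↦ ?_
    rw [Algebra.smul_def]
    exact V.mul_mem _ _ (hV _) (pow_mem ha _)
  intro x hx
  obtain ⟨p, q, rfl⟩ := (IntermediateField.mem_adjoin_simple_iff k x).1 hx
  by_cases hq : q = 0
  · simp [hq]
  · rw [div_eq_mul_inv]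
    exact V.mul_mem _ _ (hmem p) (hinv q hq)

/-- An element whose inverse is not in `V` is a nonzero element of the maximal ideal, and the
maximal ideal is closed under subtraction. -/
theorem ValuationSubring.inv_sub_notMem {V : ValuationSubring Ω} {x y : Ω} (hx : x⁻¹ ∉ V)
    (hy : y⁻¹ ∉ V) (hxy : x ≠ y) : (x - y)⁻¹ ∉ V := by
  have h {z : Ω} (hz : z⁻¹ ∉ V) : V.valuation z < 1 := by
    rw [← V.valuation_le_one_iff, map_inv₀, not_le] at hz
    exact (one_lt_inv₀ (zero_lt_iff.2 fun h0 ↦ by simp [h0] at hz)).1 hz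
  rw [← V.valuation_le_one_iff, map_inv₀, not_le]
  exact (one_lt_inv₀ (zero_lt_iff.2 (V.valuation.ne_zero_iff.2 (sub_ne_zero.2 hxy)))).2
    (V.valuation.map_sub_lt (h hx) (h hy))

theorem IsAlgebraic.of_adjoin_simple [Algebra.IsAlgebraic K Ω] {t : K}
    (h : Algebra.IsAlgebraic (IntermediateField.adjoin k {t}) K) (y : Ω) :
    IsAlgebraic (IntermediateField.adjoin k {algebraMap K Ω t}) y := by
  have : Algebra.IsAlgebraic (IntermediateField.adjoin k {t}) Ω := .trans _ K _
  obtain ⟨p, hp, hpy⟩ := Algebra.IsAlgebraic.isAlgebraic (R := IntermediateField.adjoin k {t}) y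
  have hmem (x : IntermediateField.adjoin k {t}) :
      (algebraMap (IntermediateField.adjoin k {t}) Ω) x ∈
        IntermediateField.adjoin k {algebraMap K Ω t} := by
    have h := IntermediateField.adjoin_map k {t} (IsScalarTower.toAlgHom k K Ω)
    rw [Set.image_singleton] at h
    exact h.le ⟨x, x.2, rfl⟩
  let f := (algebraMap (IntermediateField.adjoin k {t}) Ω).codRestrict
    (IntermediateField.adjoin k {algebraMap K Ω t}) hmem
  refine ⟨p.map f, (Polynomial.map_ne_zero_iff f.injective).2 hp, ?_⟩
  rw [aeval_def, eval₂_map]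
  exact hpy

variable [CharZero k] [IsAlgClosed Ω]

/-- As `pr ∘ s = id`, the section induces the full Galois action on the algebraic closure of `k`,
whose fixed field is `k` in characteristic zero. -/
theorem GaloisSection.exists_algebraMap_eq (s : GaloisSection k K Ω) {c : Ω}
    (hc : IsAlgebraic k c) (h : ∀ τ, s.toHom τ c = c) : ∃ b : k, algebraMap k Ω b = c := by
  let c' : algebraicClosure k Ω := ⟨c, mem_algebraicClosure_iff.2 hc⟩
  have : IsGalois k (algebraicClosure k Ω) := inferInstance
  obtain ⟨b, hb⟩ := (InfiniteGalois.mem_range_algebraMap_iff_fixed (k := k) c').2 fun τ ↦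
    Subtype.ext ((s.toHom_apply_coe τ c').symm.trans (h τ))
  exact ⟨b, congr_arg Subtype.val hb⟩

/-- The residue field of the restriction of a stable place to the base field is `k`. -/
theorem GaloisSection.IsStablePlace.exists_sub_eq_zero_or {s : GaloisSection k K Ω}
    {V : ValuationSubring Ω} (h : s.IsStablePlace V)
    (htr : ∀ t : K, Transcendental k t → ∀ y : Ω,
      IsAlgebraic (IntermediateField.adjoin k {algebraMap K Ω t}) y)
    {a : K} (ha : algebraMap K Ω a ∈ V) :
    ∃ c : k, a - algebraMap k K c = 0 ∨ (algebraMap K Ω (a - algebraMap k K c))⁻¹ ∉ V := by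
  by_cases hat : Transcendental k a
  -- If no `a - c` were a nonzero element of the maximal ideal, `V` would contain `k(a)` and then
  -- everything algebraic over it, which is `Ω`.
  · obtain ⟨c, hc, hcV⟩ : ∃ c : Ω, IsAlgebraic k c ∧ (algebraMap K Ω a - c)⁻¹ ∉ V := by
      by_contra! hcon
      refine h.ne_top (eq_top_iff.2 fun y _ ↦ ?_)
      exact V.mem_of_isAlgebraic _ (V.adjoin_le_of_inv_sub_mem h.algebraMap_mem ha hcon)
        (htr a hat y)
    -- By stability `a - τ(c)` is in the maximal ideal too. If `τ(c) ≠ c`, the difference of the two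
    -- is a nonzero algebraic element in the maximal ideal, whereas its inverse is algebraic and
    -- thus in `V`.
    have hfix : ∀ τ, s.toHom τ c = c := by
      intro τ
      by_contra hne
      have hτ : (algebraMap K Ω a - s.toHom τ c)⁻¹ ∉ V := by
        rwa [← h.apply_mem_iff τ, map_inv₀, map_sub, AlgEquiv.commutes] at hcV
      refine V.inv_sub_notMem hτ hcV (fun e ↦ hne (sub_right_injective e))
        (V.algebraicClosure_mem h.algebraMap_mem (k := k) ?_)
      rw [sub_sub_sub_cancel_left]
      have hτc : IsAlgebraic k (s.toHom τ c) :=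
        IsAlgebraic.algHom ((s.toHom τ).restrictScalars k).toAlgHom hc
      exact (hc.sub hτc).inv
    obtain ⟨b, rfl⟩ := s.exists_algebraMap_eq hc hfix
    refine ⟨b, .inr ?_⟩
    rwa [map_sub, ← IsScalarTower.algebraMap_apply]
  · have hat' : IsAlgebraic k (algebraMap K Ω a) := by
      rw [isAlgebraic_algebraMap_iff (RingHom.injective _)]
      exact not_not.1 hat
    obtain ⟨b, hb⟩ := s.exists_algebraMap_eq hat' fun τ ↦ AlgEquiv.commutes _ _
    refine ⟨b, .inl ?_⟩
    rw [IsScalarTower.algebraMap_apply k K Ω] at hb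
    rw [(algebraMap K Ω).injective hb, sub_self]

end Galois

/-! ### The section conjecture in terms of stable places -/

namespace SmoothProperCurve

variable {k : Type u} [Field k] [CharZero k] (C : SmoothProperCurve k)

instance : IsAlgClosed C.SepClosure :=
  have : CharZero C.FunctionField := charZero_of_injective_algebraMap (algebraMap k _).injective
  have : CharZero C.SepClosure :=
    charZero_of_injective_algebraMap (algebraMap C.FunctionField _).injective
  IsSepClosed.isAlgClosed_of_perfectField _

/-- The restriction of a stable place to the function field is the local ring at a rational
point. -/
theorem exists_localRing_eq_of_isStablePlace {Ω : Type u} [Field Ω] [IsAlgClosed Ω]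
    [Algebra C.FunctionField Ω] [Algebra k Ω]
    [IsScalarTower k C.FunctionField Ω] [Algebra.IsAlgebraic C.FunctionField Ω]
    (s : GaloisSection k C.FunctionField Ω) {V : ValuationSubring Ω} (h : s.IsStablePlace V) :
    ∃ p : C.RationalPoint,
      C.localRing p.pt = (V.comap (algebraMap C.FunctionField Ω)).toSubring := by
  refine C.exists_rationalPoint _ (fun c ↦ ?_) fun a ha ↦ ?_
  · rw [ValuationSubring.mem_comap, ← IsScalarTower.algebraMap_apply]
    exact h.algebraMap_mem c
  · obtain ⟨c, hc⟩ := h.exists_sub_eq_zero_or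
      (fun t ht y ↦ .of_adjoin_simple (C.exists_transcendental.2 t ht) y) ha
    refine ⟨c, hc.imp id fun hc' ↦ ?_⟩
    rwa [ValuationSubring.mem_comap, map_inv₀]

/-- A decomposition group at `p` that contains the image of `s` is the same as a stable place over
the local ring of `p`, nontrivial because that local ring is not the whole field. Every stable place
lies over some rational point, and a point is determined by its local ring. This form no longer
mentions points, which permits changing the curve. -/
theorem bgasc_iff_isStablePlace : C.BGASC ↔
    ∀ s : GaloisSection k C.FunctionField C.SepClosure,
      (∃ V, s.IsStablePlace V) ∧ ∀ V V', s.IsStablePlace V → s.IsStablePlace V' →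
        V.comap (algebraMap C.FunctionField C.SepClosure) =
          V'.comap (algebraMap C.FunctionField C.SepClosure) := by
  have key (s : GaloisSection k C.FunctionField C.SepClosure) (p : C.RationalPoint) :
      (∃ D : Subgroup Gal(C.SepClosure/C.FunctionField),
        C.IsDecompositionSubgroup p D ∧ s.toHom.range ≤ D) ↔
      ∃ V, s.IsStablePlace V ∧
        C.localRing p.pt = (V.comap (algebraMap C.FunctionField C.SepClosure)).toSubring := by
    constructor
    · rintro ⟨_, ⟨V, hV, rfl⟩, hD⟩
      refine ⟨V, ⟨fun c ↦ ?_, ?_, fun τ ↦ ?_⟩, hV.symm⟩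
      · have := C.algebraMap_mem_localRing p.pt c
        rw [← hV] at this
        rwa [IsScalarTower.algebraMap_apply k C.FunctionField C.SepClosure]
      · rintro rfl
        apply p.localRing_ne_top
        rw [← hV]
        exact eq_top_iff.2 fun _ _ ↦ trivial
      · exact mem_decompositionSubgroup_iff.1 (hD ⟨τ, rfl⟩)
    · rintro ⟨V, h, hV⟩
      refine ⟨_, ⟨V, hV.symm, rfl⟩, ?_⟩
      rintro _ ⟨τ, rfl⟩
      exact mem_decompositionSubgroup_iff.2 (h.apply_mem_iff τ)
  refine forall_congr' fun s ↦ ?_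
  simp only [key]
  constructor
  · rintro ⟨p, ⟨V, hV, hp⟩, hu⟩
    refine ⟨⟨V, hV⟩, fun V₁ V₂ h₁ h₂ ↦ ?_⟩
    obtain ⟨p₁, hp₁⟩ := C.exists_localRing_eq_of_isStablePlace s h₁
    obtain ⟨p₂, hp₂⟩ := C.exists_localRing_eq_of_isStablePlace s h₂
    apply ValuationSubring.toSubring_injective
    rw [← hp₁, ← hp₂, hu p₁ ⟨V₁, h₁, hp₁⟩, hu p₂ ⟨V₂, h₂, hp₂⟩]
  · rintro ⟨⟨V, hV⟩, hu⟩
    obtain ⟨p, hp⟩ := C.exists_localRing_eq_of_isStablePlace s hV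
    refine ⟨p, ⟨V, hV, hp⟩, ?_⟩
    rintro q ⟨V', hV', hq⟩
    apply RationalPoint.ext_localRing
    rw [hq, hp, hu V V' hV hV']

end SmoothProperCurve

/-! ### Transport of sections, and quadratic twists -/

section Galois

variable {k K Ω : Type*} [Field k] [Field K] [Field Ω] [Algebra k K] [Algebra K Ω] [Algebra k Ω]
  [IsScalarTower k K Ω]

theorem continuous_autCongr {L L' : Type*} [Field L] [Field L'] [Algebra k L] [Algebra k L']
    [Algebra.IsIntegral k L] (e : L ≃ₐ[k] L') : Continuous e.autCongr := by
  refine continuous_of_forall_mem_nhds e.autCongr.toMonoidHom fun y ↦ ?_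
  refine Filter.mem_of_superset (mem_nhds_one_of_continuous (.id _) continuous_id (e.symm y))
    fun τ hτ ↦ ?_
  have hτ' : τ (e.symm y) = e.symm y := hτ
  change e (τ (e.symm y)) = y
  rw [hτ', e.apply_symm_apply]

/-- Transport of a Galois section along an isomorphism of the extension fields which maps the new
base field to elements that are fixed by the section. -/
theorem GaloisSection.exists_transport {K' Ω' : Type*} [Field K'] [Field Ω'] [Algebra k K']
    [Algebra K' Ω'] [Algebra k Ω'] [IsScalarTower k K' Ω'] [Algebra.IsIntegral K Ω]
    (s : GaloisSection k K Ω)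
    (e : Ω' ≃ₐ[k] Ω)
    (h : ∀ τ y, s.toHom τ (e (algebraMap K' Ω' y)) = e (algebraMap K' Ω' y)) :
    ∃ s' : GaloisSection k K' Ω', ∀ τ x,
      e (s'.toHom τ x) = s.toHom ((algebraicClosure.algEquivOfAlgEquiv e).autCongr τ) (e x) := by
  let a := (algebraicClosure.algEquivOfAlgEquiv e).autCongr
  let f : Gal(algebraicClosure k Ω'/k) →* Gal(Ω'/K') :=
    { toFun τ := AlgEquiv.ofRingEquiv
        (f := ((e.trans ((s.toHom (a τ)).restrictScalars k)).trans e.symm).toRingEquiv) fun y ↦ by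
          change e.symm (s.toHom (a τ) (e (algebraMap K' Ω' y))) = _
          rw [h, e.symm_apply_apply]
      map_one' := by
        ext x
        change e.symm (s.toHom (a 1) (e x)) = x
        simp
      map_mul' σ τ := by
        ext x
        change e.symm (s.toHom (a (σ * τ)) (e x)) =
          e.symm (s.toHom (a σ) (e (e.symm (s.toHom (a τ) (e x)))))
        simp }
  have hf (τ x) : f τ x = e.symm (s.toHom (a τ) (e x)) := rfl
  refine ⟨⟨f, ?_, ?_⟩, fun τ x ↦ ?_⟩
  · refine continuous_of_forall_mem_nhds f fun y ↦ ?_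
    refine Filter.mem_of_superset (mem_nhds_one_of_continuous (s.toHom.comp a.toMonoidHom)
      (s.continuous_toHom.comp (continuous_autCongr _)) (e y)) fun τ hτ ↦ ?_
    have hτ' : s.toHom (a τ) (e y) = e y := hτ
    change f τ y = y
    rw [hf, hτ', e.symm_apply_apply]
  · ext τ c
    change f τ c = τ c
    rw [hf, e.symm_apply_eq]
    have := s.toHom_apply_coe (a τ) (algebraicClosure.algEquivOfAlgEquiv e c)
    refine this.trans ?_
    change e (τ ((algebraicClosure.algEquivOfAlgEquiv e).symm _) : algebraicClosure k Ω') = _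
    rw [AlgEquiv.symm_apply_apply]
  · exact e.apply_symm_apply _

theorem GaloisSection.IsStablePlace.comap {K' Ω' : Type*} [Field K'] [Field Ω'] [Algebra k K']
    [Algebra K' Ω'] [Algebra k Ω'] [IsScalarTower k K' Ω'] {s : GaloisSection k K Ω}
    {s' : GaloisSection k K' Ω'} {e : Ω' ≃ₐ[k] Ω}
    (h : ∀ τ x, e (s'.toHom τ x) =
      s.toHom ((algebraicClosure.algEquivOfAlgEquiv e).autCongr τ) (e x))
    {V : ValuationSubring Ω} (hV : s.IsStablePlace V) :
    s'.IsStablePlace (V.comap (e : Ω' →+* Ω)) where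
  algebraMap_mem c := by
    rw [ValuationSubring.mem_comap]
    simpa using hV.algebraMap_mem c
  ne_top htop := hV.ne_top <| eq_top_iff.2 fun y _ ↦ by
    have : e.symm y ∈ V.comap (e : Ω' →+* Ω) := htop ▸ trivial
    simpa [ValuationSubring.mem_comap] using this
  apply_mem_iff τ x := by
    rw [ValuationSubring.mem_comap, ValuationSubring.mem_comap]
    change e _ ∈ V ↔ e x ∈ V
    rw [h, hV.apply_mem_iff]

theorem GaloisSection.IsStablePlace.comap_symm {K' Ω' : Type*} [Field K'] [Field Ω'] [Algebra k K']
    [Algebra K' Ω'] [Algebra k Ω'] [IsScalarTower k K' Ω'] {s : GaloisSection k K Ω}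
    {s' : GaloisSection k K' Ω'} {e : Ω' ≃ₐ[k] Ω}
    (h : ∀ τ x, e (s'.toHom τ x) =
      s.toHom ((algebraicClosure.algEquivOfAlgEquiv e).autCongr τ) (e x))
    {V : ValuationSubring Ω'} (hV : s'.IsStablePlace V) :
    s.IsStablePlace (V.comap (e.symm : Ω →+* Ω')) where
  algebraMap_mem c := by
    rw [ValuationSubring.mem_comap]
    simpa using hV.algebraMap_mem c
  ne_top htop := hV.ne_top <| eq_top_iff.2 fun y _ ↦ by
    have : e y ∈ V.comap (e.symm : Ω →+* Ω') := htop ▸ trivial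
    simpa [ValuationSubring.mem_comap] using this
  apply_mem_iff τ x := by
    rw [ValuationSubring.mem_comap, ValuationSubring.mem_comap]
    change e.symm _ ∈ V ↔ e.symm x ∈ V
    have := h ((algebraicClosure.algEquivOfAlgEquiv e).autCongr.symm τ) (e.symm x)
    rw [MulEquiv.apply_symm_apply, e.apply_symm_apply] at this
    rw [← this, e.symm_apply_apply, hV.apply_mem_iff]

/-- Every element of the base field has, up to a constant, a square root that is fixed by the
section. -/
theorem GaloisSection.exists_twist [CharZero k] [IsAlgClosed Ω] [Algebra.IsIntegral K Ω]
    (s : GaloisSection k K Ω) {b : K} (hb : b ≠ 0) :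
    ∃ (c : k) (y : Ω), c ≠ 0 ∧ y ^ 2 = algebraMap k Ω c * algebraMap K Ω b ∧
      ∀ τ, s.toHom τ y = y := by
  obtain ⟨w, hw⟩ := IsAlgClosed.exists_pow_nat_eq (algebraMap K Ω b) zero_lt_two
  have hw0 : w ≠ 0 := fun h0 ↦ hb <| by
    rw [h0, zero_pow two_ne_zero, eq_comm, map_eq_zero] at hw
    exact hw
  have hsgn (τ) : s.toHom τ w = w ∨ s.toHom τ w = -w := by
    apply sq_eq_sq_iff_eq_or_eq_neg.1
    rw [← map_pow, hw, AlgEquiv.commutes]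
  -- `H` is the kernel of the sign character by which `G_k` acts on the square root `w`. It is open,
  -- hence closed, so the Galois correspondence applies to it.
  let H : Subgroup Gal(algebraicClosure k Ω/k) :=
    (MulAction.stabilizer Gal(Ω/K) w).comap s.toHom
  have hH (τ) : τ ∈ H ↔ s.toHom τ w = w := Iff.rfl
  by_cases htop : ∀ τ, s.toHom τ w = w
  · exact ⟨1, w, one_ne_zero, by rw [hw, map_one, one_mul], htop⟩
  obtain ⟨τ₀, hτ₀⟩ := not_forall.1 htop
  have hcl : IsClosed (H : Set Gal(algebraicClosure k Ω/k)) :=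
    H.isClosed_of_isOpen ((stabilizer_isOpen_of_isIntegral (K := K) w).preimage s.continuous_toHom)
  have hfix := InfiniteGalois.fixingSubgroup_fixedField (⟨H, hcl⟩ : ClosedSubgroup _)
  obtain ⟨e, he, hne⟩ : ∃ e ∈ IntermediateField.fixedField H, τ₀ e ≠ e := by
    by_contra! hcon
    exact hτ₀ (hfix.le ((IntermediateField.mem_fixingSubgroup_iff _ _).2 hcon))
  have he' (σ) (hσ : s.toHom σ w = w) : σ e = e :=
    (IntermediateField.mem_fixedField_iff _ _).1 he σ hσ
  have hneg {σ} (hσ : s.toHom σ w ≠ w) : s.toHom σ w = -w := (hsgn σ).resolve_left hσ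
  have hmul (σ τ) : s.toHom (σ * τ) w = s.toHom σ (s.toHom τ w) := by rw [map_mul]; rfl
  have hinv : s.toHom τ₀⁻¹ w = -w := by
    apply hneg
    intro h
    have := hmul τ₀ τ₀⁻¹
    rw [mul_inv_cancel, map_one, h] at this
    exact hτ₀ this.symm
  -- `d` is a nonzero algebraic element on which `G_k` acts by the same sign as on `w`. So `d * w`
  -- is fixed and `d ^ 2` is the required constant of `k`.
  let d := e - τ₀ e
  have hd0 : d ≠ 0 := sub_ne_zero.2 hne.symm
  have hd (σ) : (s.toHom σ w = w ∧ σ d = d) ∨ (s.toHom σ w = -w ∧ σ d = -d) := by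
    by_cases hσ : s.toHom σ w = w
    · refine .inl ⟨hσ, ?_⟩
      have h1 := he' (τ₀⁻¹ * (σ * τ₀)) (by
        rw [hmul, hmul, hneg hτ₀, map_neg, hσ, map_neg, hinv, neg_neg])
      have h1 : σ (τ₀ e) = τ₀ e := τ₀.symm_apply_eq.1 h1
      rw [map_sub, he' σ hσ, h1]
    · refine .inr ⟨hneg hσ, ?_⟩
      have h1 := he' (τ₀⁻¹ * σ) (by rw [hmul, hneg hσ, map_neg, hinv, neg_neg])
      have h1 : σ e = τ₀ e := τ₀.symm_apply_eq.1 h1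
      have h2 := he' (σ * τ₀) (by rw [hmul, hneg hτ₀, map_neg, hneg hσ, neg_neg])
      rw [AlgEquiv.mul_apply] at h2
      rw [map_sub, h1, h2, neg_sub]
  obtain ⟨c, hc⟩ := (InfiniteGalois.mem_range_algebraMap_iff_fixed (k := k) (d ^ 2)).2 fun σ ↦ by
    rcases hd σ with ⟨-, h⟩ | ⟨-, h⟩ <;> simp [map_pow, h]
  refine ⟨c, d * w, ?_, ?_, fun σ ↦ ?_⟩
  · rintro rfl
    exact hd0 (by simpa [eq_comm (a := (0 : algebraicClosure k Ω))] using hc)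
  · rw [mul_pow, hw]
    congr 1
    exact congr_arg Subtype.val hc.symm
  · rw [map_mul, s.toHom_apply_coe]
    rcases hd σ with ⟨h1, h2⟩ | ⟨h1, h2⟩ <;> simp [h1, h2]

end Galois

/-! ### Standard smoothness of plane curves -/

section Polynomial

open Polynomial

theorem isStandardSmoothOfRelativeDimension_polynomial (k : Type u) [CommRing k] :
    Algebra.IsStandardSmoothOfRelativeDimension 1 k k[X] := by
  have hinj : Function.Injective (MvPolynomial.aeval (R := k) fun _ : Unit ↦ (X : k[X])) :=
    (MvPolynomial.uniqueAlgEquiv k Unit).injective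
  have hsurj : Function.Surjective (MvPolynomial.aeval (R := k) fun _ : Unit ↦ (X : k[X])) :=
    (MvPolynomial.uniqueAlgEquiv k Unit).surjective
  let P : Algebra.PreSubmersivePresentation k k[X] Unit PEmpty.{1} :=
    { toGenerators := .ofSurjective (fun _ ↦ X) hsurj
      relation := PEmpty.elim
      span_range_relation_eq_ker := by
        simp only [Set.range_eq_empty, Ideal.span_empty]
        exact ((RingHom.injective_iff_ker_eq_bot _).1 hinj).symm
      map := PEmpty.elim
      map_inj a := a.elim }
  refine (show Algebra.SubmersivePresentation k k[X] Unit PEmpty.{1} from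
    { P with jacobian_isUnit := ?_ }).isStandardSmoothOfRelativeDimension ?_
  · rw [P.jacobian_eq_jacobiMatrix_det, Matrix.det_isEmpty, map_one]
    exact isUnit_one
  · simp [Algebra.Presentation.dimension]

/-- The localisation of a plane curve `k[X, Y]/(f)` at an element that divides a power of the
derivative of `f` with respect to `Y` is standard smooth. -/
theorem isStandardSmoothOfRelativeDimension_away_adjoinRoot {k : Type u} [CommRing k]
    (P : StandardEtalePair k[X]) :
    Algebra.IsStandardSmoothOfRelativeDimension 1 k
      (Localization.Away (AdjoinRoot.mk P.f P.g)) := by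
  have := isStandardSmoothOfRelativeDimension_polynomial k
  have : Algebra.IsStandardEtale k[X] (Localization.Away (AdjoinRoot.mk P.f P.g)) :=
    .of_equiv P.equivAwayAdjoinRoot
  obtain ⟨Q⟩ := this.nonempty_standardEtalePresentation
  have : Algebra.IsStandardSmoothOfRelativeDimension 0 k[X]
      (Localization.Away (AdjoinRoot.mk P.f P.g)) :=
    Q.toSubmersivePresentation.isStandardSmoothOfRelativeDimension (by
      simp [Algebra.Presentation.dimension])
  exact Algebra.IsStandardSmoothOfRelativeDimension.trans (n := 1) (m := 0) k k[X] _

end Polynomial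

/-! ### The affine curve `y² = c(x^N + 1)` -/

section Hyperelliptic

open Polynomial

/-- The equation `Y² = c(X ^ N + 1)`, as a polynomial in `Y`. -/
noncomputable abbrev doubleCoverPoly {k : Type u} [CommRing k] (c : k) (N : ℕ) : k[X][X] :=
  X ^ 2 - C (C c * (X ^ N + 1))

theorem monic_doubleCoverPoly {k : Type u} [CommRing k] (c : k) (N : ℕ) :
    (doubleCoverPoly c N).Monic := monic_X_pow_sub_C _ two_ne_zero

theorem root_doubleCoverPoly_sq {k : Type u} [CommRing k] (c : k) (N : ℕ) :
    AdjoinRoot.root (doubleCoverPoly c N) ^ 2 =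
      algebraMap k _ c * (AdjoinRoot.of (doubleCoverPoly c N) X ^ N + 1) := by
  have h := AdjoinRoot.eval₂_root (doubleCoverPoly c N)
  rw [eval₂_sub, eval₂_X_pow, eval₂_C, sub_eq_zero] at h
  simpa only [map_mul, map_add, map_pow, map_one] using! h

variable {k E : Type u} [Field k] {c : k} {N : ℕ} [Field E] [Algebra k E] {x y : E}

/-- The evaluation of functions on the affine curve `Y² = c(X ^ N + 1)`. -/
noncomputable def doubleCoverEval (hy : y ^ 2 = algebraMap k E c * (x ^ N + 1)) :
    AdjoinRoot (doubleCoverPoly c N) →ₐ[k] E :=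
  AdjoinRoot.liftAlgHom _ (aeval x) y (by
    simp only [eval₂_sub, eval₂_X_pow, eval₂_C]
    simp [hy])

theorem doubleCoverEval_range (hy : y ^ 2 = algebraMap k E c * (x ^ N + 1)) :
    (doubleCoverEval hy).range = Algebra.adjoin k {x, y} := by
  apply le_antisymm
  · rintro _ ⟨f, rfl⟩
    obtain ⟨p, rfl⟩ := AdjoinRoot.mk_surjective f
    change doubleCoverEval hy _ ∈ _
    rw [doubleCoverEval, AdjoinRoot.liftAlgHom_mk, eval₂_eq_sum]
    refine sum_mem fun i _ ↦ mul_mem ?_ (pow_mem (Algebra.subset_adjoin (by simp)) _)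
    exact Algebra.adjoin_mono (by simp) (aeval_mem_adjoin_singleton k x)
  · rw [Algebra.adjoin_le_iff]
    rintro z (rfl | rfl)
    · exact ⟨AdjoinRoot.of _ X, by simp [doubleCoverEval]⟩
    · exact ⟨AdjoinRoot.root _, by simp [doubleCoverEval]⟩

variable [CharZero k]

theorem squarefree_C_mul_X_pow_add_one (hc : c ≠ 0) (hN : N ≠ 0) :
    Squarefree (C c * (X ^ N + 1) : k[X]) := by
  have h : (X ^ N + 1 : k[X]) = X ^ N - C (-1) := by simp
  have hs := (separable_X_pow_sub_C (-1 : k) (Nat.cast_ne_zero.2 hN) (by simp)).squarefree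
  rw [h]
  exact (Associated.squarefree_iff
    (associated_unit_mul_left _ _ (isUnit_C.2 hc.isUnit))).2 hs


/-- The elements `1` and `y` are linearly independent over `k(x)`. -/
theorem eq_zero_of_aeval_add_aeval_mul_eq_zero (hx : Transcendental k x) (hc : c ≠ 0) (hN : N ≠ 0)
    (hy : y ^ 2 = algebraMap k E c * (x ^ N + 1)) {a b : k[X]}
    (h : aeval x a + aeval x b * y = 0) : a = 0 ∧ b = 0 := by
  have hinj : Function.Injective (aeval x : k[X] →ₐ[k] E) := transcendental_iff_injective.1 hx
  have hsq : a ^ 2 = b ^ 2 * (C c * (X ^ N + 1)) := by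
    apply hinj
    simp only [map_pow, map_mul, map_add, aeval_C, aeval_X, map_one]
    rw [← hy]
    linear_combination (aeval x a - aeval x b * y) * h
  -- Otherwise `b` divides `a`, and the quotient `q` satisfies `q² = c(X^N + 1)`. The right side is
  -- squarefree, so `q` is a unit, and the degree `N ≠ 0` gives a contradiction.
  have hb : b = 0 := by
    by_contra hb
    obtain ⟨q, rfl⟩ : b ∣ a := (IsIntegrallyClosed.pow_dvd_pow_iff two_ne_zero).1 ⟨_, hsq⟩
    rw [mul_pow] at hsq
    have hq := mul_left_cancel₀ (pow_ne_zero 2 hb) hsq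
    have hu : IsUnit q := squarefree_C_mul_X_pow_add_one hc hN q ⟨1, by rw [← hq]; ring⟩
    have hd := congr_arg natDegree hq
    rw [natDegree_pow, natDegree_eq_zero_of_isUnit hu, natDegree_C_mul hc,
      show (X ^ N + 1 : k[X]) = X ^ N + C 1 by simp, natDegree_X_pow_add_C] at hd
    omega
  subst hb
  rw [map_zero, zero_mul, add_zero] at h
  exact ⟨hinj (h.trans (map_zero _).symm), rfl⟩

/-- Division by the monic quadratic leaves a remainder linear in `Y`, and `1` and `y` are
independent over `k[x]`. -/
theorem doubleCoverEval_injective (hx : Transcendental k x) (hc : c ≠ 0) (hN : N ≠ 0)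
    (hy : y ^ 2 = algebraMap k E c * (x ^ N + 1)) :
    Function.Injective (doubleCoverEval hy) := by
  rw [injective_iff_map_eq_zero]
  intro f hf
  obtain ⟨p, rfl⟩ := AdjoinRoot.mk_surjective f
  have hm := monic_doubleCoverPoly c N
  have hdeg : (p %ₘ doubleCoverPoly c N).degree ≤ 1 := by
    have := degree_modByMonic_lt p hm
    rw [degree_X_pow_sub_C two_pos] at this
    exact Order.le_of_lt_succ this
  obtain ⟨a, b, hab⟩ : ∃ a b, p %ₘ doubleCoverPoly c N = C a * X + C b :=
    ⟨_, _, eq_X_add_C_of_degree_le_one hdeg⟩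
  have hp : AdjoinRoot.mk (doubleCoverPoly c N) p =
      AdjoinRoot.mk (doubleCoverPoly c N) (p %ₘ doubleCoverPoly c N) := by
    rw [AdjoinRoot.mk_eq_mk]
    exact ⟨p /ₘ doubleCoverPoly c N, by
      linear_combination (modByMonic_add_div p (doubleCoverPoly c N)).symm⟩
  rw [hp, hab] at hf ⊢
  rw [doubleCoverEval, AdjoinRoot.liftAlgHom_mk] at hf
  have := eq_zero_of_aeval_add_aeval_mul_eq_zero hx hc hN hy (a := b) (b := a) (by
    rw [← hf]
    simp [add_comm])
  simp [this.1, this.2]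

variable (k) in
theorem isDomain_doubleCover (hc : c ≠ 0) (hN : N ≠ 0) :
    IsDomain (AdjoinRoot (doubleCoverPoly c N)) := by
  let E := AlgebraicClosure (RatFunc k)
  obtain ⟨y, hy⟩ := IsAlgClosed.exists_pow_nat_eq
    (algebraMap k E c * ((algebraMap (RatFunc k) E RatFunc.X) ^ N + 1)) zero_lt_two
  have hx : Transcendental k (algebraMap (RatFunc k) E RatFunc.X) :=
    (transcendental_algebraMap_iff (algebraMap (RatFunc k) E).injective).2 RatFunc.transcendental_X
  exact (doubleCoverEval_injective hx hc hN hy).isDomain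

open TensorProduct in
-- The base change is again a curve of the same form over `K`: the map `φ` to its coordinate ring
-- has a left inverse, so it embeds in a domain.
theorem isDomain_tensorProduct_doubleCover (hc : c ≠ 0) (hN : N ≠ 0) (K : Type u) [Field K]
    [Algebra k K] : IsDomain (K ⊗[k] AdjoinRoot (doubleCoverPoly c N)) := by
  have : CharZero K := charZero_of_injective_algebraMap (algebraMap k K).injective
  have := isDomain_doubleCover K (c := algebraMap k K c) (by simpa using hc) hN
  let φ : K ⊗[k] AdjoinRoot (doubleCoverPoly c N) →ₐ[K]
      AdjoinRoot (doubleCoverPoly (algebraMap k K c) N) :=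
    Algebra.TensorProduct.lift (Algebra.ofId _ _)
      (AdjoinRoot.mapAlgHom (Polynomial.mapAlgHom (Algebra.ofId k K)) _ _ (by
        simp [doubleCoverPoly, Polynomial.map_sub, Polynomial.map_pow]))
      fun _ _ ↦ .all _ _
  let ψ : AdjoinRoot (doubleCoverPoly (algebraMap k K c) N) →ₐ[K]
      K ⊗[k] AdjoinRoot (doubleCoverPoly c N) :=
    AdjoinRoot.liftAlgHom _ (aeval (1 ⊗ₜ AdjoinRoot.of _ X)) (1 ⊗ₜ AdjoinRoot.root _) (by
      have h := congr_arg (Algebra.TensorProduct.includeRight :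
        _ →ₐ[k] K ⊗[k] AdjoinRoot (doubleCoverPoly c N)) (root_doubleCoverPoly_sq c N)
      simp only [eval₂_sub, eval₂_X_pow, eval₂_C]
      simp only [map_pow, map_mul, map_add, map_one, AlgHom.commutes,
        Algebra.TensorProduct.includeRight_apply] at h
      simp [h, ← IsScalarTower.algebraMap_apply])
  have h : ψ.comp φ = .id _ _ := by
    ext
    · simp [φ, ψ]
    · simp [φ, ψ]
  have : Function.LeftInverse ψ φ := fun a ↦ congr($h a)
  exact this.injective.isDomain

/-- The open sets `x ≠ 0` and `y ≠ 0` cover the curve, since `y² - c x^N = c`. Where `y ≠ 0` the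
curve is étale over the `x`-line, with derivative `2y`. Where `x ≠ 0` it is étale over the `y`-line,
the equation being read as a polynomial in `x` with derivative `N x^(N-1)`. -/
theorem locally_isStandardSmoothOfRelativeDimension_doubleCover (hc : c ≠ 0) (hN : N ≠ 0) :
    RingHom.Locally (RingHom.IsStandardSmoothOfRelativeDimension 1)
      (algebraMap k (AdjoinRoot (doubleCoverPoly c N))) := by
  refine ⟨{AdjoinRoot.of _ X, AdjoinRoot.root _}, ?_, ?_⟩
  · rw [Ideal.eq_top_iff_one, Ideal.mem_span_pair]
    obtain ⟨m, rfl⟩ : ∃ m, N = m + 1 := ⟨N - 1, by omega⟩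
    refine ⟨-AdjoinRoot.of _ X ^ m, algebraMap k _ c⁻¹ * AdjoinRoot.root _, ?_⟩
    rw [mul_assoc, ← pow_two, root_doubleCoverPoly_sq, ← mul_assoc, ← map_mul,
      inv_mul_cancel₀ hc, map_one]
    ring
  rintro t (rfl | rfl)
  -- The roles are exchanged here: the base variable stands for `y`, and the root of `P.f` is `x`.
  · let P : StandardEtalePair k[X] :=
      { f := X ^ N + C (1 - C c⁻¹ * X ^ 2)
        monic_f := monic_X_pow_add_C _ hN
        g := X
        cond := ⟨C (C (N : k)⁻¹), 0, N - 1, by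
          rw [derivative_add, derivative_X_pow, derivative_C, add_zero, mul_zero, add_zero,
            mul_right_comm, ← C_eq_natCast, ← C_mul, ← C_mul,
            mul_inv_cancel₀ (Nat.cast_ne_zero.2 hN), C_1, C_1, one_mul]⟩ }
    have hP : AdjoinRoot.of P.f X ^ 2 =
        algebraMap k _ c * (AdjoinRoot.root P.f ^ N + 1) := by
      have h := AdjoinRoot.eval₂_root P.f
      rw [eval₂_add, eval₂_X_pow, eval₂_C, map_sub, map_mul, map_one, map_pow] at h
      have h' : AdjoinRoot.of P.f (C c⁻¹) = algebraMap k _ c⁻¹ := rfl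
      rw [h'] at h
      have h1 : algebraMap k (AdjoinRoot P.f) c * algebraMap k _ c⁻¹ = 1 := by
        rw [← map_mul, mul_inv_cancel₀ hc, map_one]
      linear_combination (AdjoinRoot.of P.f X ^ 2) * (-h1) - algebraMap k _ c * h
    have hQ := root_doubleCoverPoly_sq c N
    let φ : AdjoinRoot P.f →ₐ[k] AdjoinRoot (doubleCoverPoly c N) :=
      AdjoinRoot.liftAlgHom _ (aeval (AdjoinRoot.root _)) (AdjoinRoot.of _ X) (by
        rw [eval₂_add, eval₂_X_pow, eval₂_C]
        have h1 : algebraMap k (AdjoinRoot (doubleCoverPoly c N)) c⁻¹ * algebraMap k _ c = 1 := by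
          rw [← map_mul, inv_mul_cancel₀ hc, map_one]
        simp only [RingHom.coe_coe, map_sub, map_mul, map_one, map_pow,
          aeval_C, aeval_X, hQ]
        linear_combination (-(AdjoinRoot.of (doubleCoverPoly c N) X ^ N + 1)) * h1)
    let ψ : AdjoinRoot (doubleCoverPoly c N) →ₐ[k] AdjoinRoot P.f :=
      AdjoinRoot.liftAlgHom _ (aeval (AdjoinRoot.root _)) (AdjoinRoot.of _ X) (by
        rw [eval₂_sub, eval₂_X_pow, eval₂_C]
        simp [hP])
    let e : AdjoinRoot P.f ≃ₐ[k] AdjoinRoot (doubleCoverPoly c N) :=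
      .ofAlgHom φ ψ
        (by
          apply AdjoinRoot.algHom_ext'
          · ext
            simp [φ, ψ]
          · simp [φ, ψ])
        (by
          apply AdjoinRoot.algHom_ext'
          · ext
            simp [φ, ψ]
          · simp [φ, ψ])
    have he : e (AdjoinRoot.mk P.f P.g) = AdjoinRoot.of _ X := by
      simp [e, φ, P]
    have := isStandardSmoothOfRelativeDimension_away_adjoinRoot P
    rw [← IsScalarTower.algebraMap_eq, RingHom.isStandardSmoothOfRelativeDimension_algebraMap]
    exact .of_algEquiv 1 (IsLocalization.algEquivOfAlgEquiv (M := .powers (AdjoinRoot.mk P.f P.g))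
      (T := .powers (AdjoinRoot.of _ X))
      (Localization.Away (AdjoinRoot.mk P.f P.g)) _ e (by
        rw [Submonoid.map_powers]
        exact congr_arg _ he))
  · let P : StandardEtalePair k[X] :=
      { f := doubleCoverPoly c N
        monic_f := monic_doubleCoverPoly c N
        g := X
        cond := ⟨C (C (2 : k)⁻¹), 0, 1, by
          rw [derivative_sub, derivative_X_pow, derivative_C, sub_zero, mul_zero, add_zero,
            mul_right_comm, ← C_eq_natCast, ← C_mul, ← C_mul, Nat.cast_ofNat,
            mul_inv_cancel₀ two_ne_zero, C_1, C_1, one_mul]⟩ }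
    have := isStandardSmoothOfRelativeDimension_away_adjoinRoot P
    rw [← IsScalarTower.algebraMap_eq, RingHom.isStandardSmoothOfRelativeDimension_algebraMap]
    exact this

end Hyperelliptic

/-! ### Geometric connectedness of a gluing -/

section Glue

open Limits TensorProduct

variable {k F : Type u} [Field k] [Field F] [Algebra k F] {A₁ A₂ B : Subalgebra k F} {x : F}

theorem isPreconnected_preimage_range {R A K : Type u} [CommRing R] [CommRing A] [CommRing K]
    [Algebra R A] [Algebra R K] [IsDomain (K ⊗[R] A)] {X : Scheme.{u}}
    {π : X ⟶ Spec (CommRingCat.of R)} {i : Spec (CommRingCat.of A) ⟶ X}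
    (h : i ≫ π = Spec.map (CommRingCat.ofHom (algebraMap R A))) :
    _root_.IsPreconnected
      (pullback.fst π (Spec.map (CommRingCat.ofHom (algebraMap R K))) ⁻¹' (Set.range i)) := by
  let s := Spec.map (CommRingCat.ofHom (algebraMap R K))
  have := (Algebra.TensorProduct.comm R A K).injective.isDomain
  let e : pullback i (pullback.fst π s) ≅ Spec (CommRingCat.of (A ⊗[R] K)) :=
    pullbackRightPullbackFstIso π s i ≪≫ pullback.congrHom h rfl ≪≫ pullbackSpecIso R A K
  have : PreconnectedSpace ↥(pullback i (pullback.fst π s)) :=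
    ⟨e.inv.homeomorph.surjective.range_eq ▸ isPreconnected_range e.inv.homeomorph.continuous⟩
  rw [← Scheme.Pullback.range_snd]
  exact isPreconnected_range (Scheme.Hom.continuous _)

/-- After base change each chart is the spectrum of a domain, hence connected. The two charts cover,
and they still meet because the base change of `Spec K ⟶ Spec k` is surjective over a point of the
overlap. -/
theorem IsGlueOf.geometricallyConnected {le₁ : A₁ ≤ B} {le₂ : A₂ ≤ B} {X : Scheme.{u}}
    {π : X ⟶ Spec (CommRingCat.of k)}
    {i₁ : Spec (CommRingCat.of A₁) ⟶ X} {i₂ : Spec (CommRingCat.of A₂) ⟶ X}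
    (H : IsGlueOf A₁ A₂ B le₁ le₂ π i₁ i₂)
    (h₁ : ∀ (K : Type u) [Field K] [Algebra k K], IsDomain (K ⊗[k] A₁))
    (h₂ : ∀ (K : Type u) [Field K] [Algebra k K], IsDomain (K ⊗[k] A₂)) :
    GeometricallyConnected π := by
  refine ⟨geometrically_iff_of_commRing_of_isClosedUnderIsomorphisms.2 fun K _ _ ↦ ?_⟩
  let φ := CommRingCat.ofHom (algebraMap k K)
  have := h₁ K
  have := h₂ K
  have hs : Surjective (Spec.map φ) := by
    have : Subsingleton (Spec (CommRingCat.of k)) :=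
      inferInstanceAs (Subsingleton (PrimeSpectrum k))
    have : Nonempty (Spec (CommRingCat.of K)) := inferInstance
    exact ⟨Function.surjective_to_subsingleton _⟩
  obtain ⟨w⟩ : Nonempty (Spec (CommRingCat.of B)) := inferInstance
  obtain ⟨p, hp⟩ := (pullback.fst π (Spec.map φ)).surjective (i₁ (specInclusion le₁ w))
  have hp' : pullback.fst π (Spec.map φ) p = i₂ (specInclusion le₂ w) :=
    hp.trans congr($H.glue w)
  have hc₁ : _root_.IsPreconnected (pullback.fst π (Spec.map φ) ⁻¹' (Set.range i₁)) :=
    isPreconnected_preimage_range (K := K) H.over₁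
  have hc₂ : _root_.IsPreconnected (pullback.fst π (Spec.map φ) ⁻¹' (Set.range i₂)) :=
    isPreconnected_preimage_range (K := K) H.over₂
  have hu : (Set.univ : Set ↥(pullback π (Spec.map φ))) =
      pullback.fst π (Spec.map φ) ⁻¹' (Set.range i₁) ∪
        pullback.fst π (Spec.map φ) ⁻¹' (Set.range i₂) :=
    (Set.eq_univ_of_forall fun q ↦ H.cover _).symm
  rw [connectedSpace_iff_univ, hu]
  exact ⟨⟨p, .inl ⟨_, hp.symm⟩⟩, hc₁.union p ⟨_, hp.symm⟩ ⟨_, hp'.symm⟩ hc₂⟩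

end Glue

/-! ### The two charts of the hyperelliptic curve -/

section Hyperelliptic

variable {k F : Type u} [Field k] [Field F] [Algebra k F] {x y : F} {c : k} {g : ℕ}

theorem ne_zero_of_transcendental (hx : Transcendental k x) : x ≠ 0 := by
  rintro rfl
  exact hx isAlgebraic_zero

/-- `X^(2g+2) + 1` is its own reversal, so the equation keeps its form in the coordinates at
infinity. Everything proved for the first chart thus applies verbatim to the second. -/
theorem sq_mul_inv_pow (hx : x ≠ 0) (hy : y ^ 2 = algebraMap k F c * (x ^ (2 * g + 2) + 1)) :
    (y * x⁻¹ ^ (g + 1)) ^ 2 = algebraMap k F c * (x⁻¹ ^ (2 * g + 2) + 1) := by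
  have h1 : x ^ (2 * g + 2) * x⁻¹ ^ (2 * g + 2) = 1 := by
    rw [← mul_pow, mul_inv_cancel₀ hx, one_pow]
  rw [mul_pow, hy]
  linear_combination algebraMap k F c * h1

theorem exists_mul_pow_mem_adjoin {b : F} (hx : x ≠ 0) (hb : b ∈ Algebra.adjoin k {x, x⁻¹, y}) :
    ∃ n : ℕ, b * x ^ n ∈ Algebra.adjoin k {x, y} := by
  have hxm : x ∈ Algebra.adjoin k {x, y} := Algebra.subset_adjoin (by simp)
  induction hb using Algebra.adjoin_induction with
  | mem b hb =>
    rcases hb with rfl | rfl | rfl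
    · exact ⟨0, by simpa using hxm⟩
    · exact ⟨1, by rw [pow_one, inv_mul_cancel₀ hx]; exact one_mem _⟩
    · exact ⟨0, by rw [pow_zero, mul_one]; exact Algebra.subset_adjoin (by simp)⟩
  | algebraMap r => exact ⟨0, by rw [pow_zero, mul_one]; exact Subalgebra.algebraMap_mem _ _⟩
  | add a b _ _ ha hb =>
    obtain ⟨m, hm⟩ := ha
    obtain ⟨n, hn⟩ := hb
    refine ⟨m + n, ?_⟩
    rw [show (a + b) * x ^ (m + n) = a * x ^ m * x ^ n + b * x ^ n * x ^ m by ring]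
    exact add_mem (mul_mem hm (pow_mem hxm _)) (mul_mem hn (pow_mem hxm _))
  | mul a b _ _ ha hb =>
    obtain ⟨m, hm⟩ := ha
    obtain ⟨n, hn⟩ := hb
    refine ⟨m + n, ?_⟩
    rw [show a * b * x ^ (m + n) = a * x ^ m * (b * x ^ n) by ring]
    exact mul_mem hm hn

theorem isIntegral_of_mem_adjoin {N : ℕ} (hy : y ^ 2 = algebraMap k F c * (x ^ N + 1)) {a : F}
    (ha : a ∈ Algebra.adjoin k {x, y}) : IsIntegral (Algebra.adjoin k {x}) a := by
  have hle : Algebra.adjoin k {x, y} ≤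
      (integralClosure (Algebra.adjoin k {x}) F).restrictScalars k := by
    rw [Algebra.adjoin_le_iff]
    rintro z (rfl | rfl)
    · exact isIntegral_algebraMap (R := Algebra.adjoin k {z}) (A := F)
        (x := ⟨z, Algebra.self_mem_adjoin_singleton k z⟩)
    · have h : IsIntegral (Algebra.adjoin k {x}) (z ^ 2) := by
        rw [hy]
        exact isIntegral_algebraMap (R := Algebra.adjoin k {x}) (A := F)
          (x := algebraMap k _ c * (⟨x, Algebra.self_mem_adjoin_singleton k x⟩ ^ N + 1))
      exact .of_pow two_pos h
  exact hle ha

theorem isChartPair_doubleCover (hx : x ≠ 0)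
    (hy : y ^ 2 = algebraMap k F c * (x ^ (2 * g + 2) + 1)) :
    IsChartPair (Algebra.adjoin k {x, y}) (Algebra.adjoin k {x⁻¹, y * x⁻¹ ^ (g + 1)})
      (Algebra.adjoin k {x, x⁻¹, y}) x := by
  -- The overlap has the same description from either chart, which makes the conditions on the
  -- second chart instances of those on the first.
  have hB : Algebra.adjoin k {x, x⁻¹, y} = Algebra.adjoin k {x⁻¹, x⁻¹⁻¹, y * x⁻¹ ^ (g + 1)} := by
    have h1 : x ∈ Algebra.adjoin k {x, x⁻¹, y} := Algebra.subset_adjoin (by simp)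
    have h2 : x⁻¹ ∈ Algebra.adjoin k {x, x⁻¹, y} := Algebra.subset_adjoin (by simp)
    have h3 : y ∈ Algebra.adjoin k {x, x⁻¹, y} := Algebra.subset_adjoin (by simp)
    rw [inv_inv]
    have h4 : x ∈ Algebra.adjoin k {x⁻¹, x, y * x⁻¹ ^ (g + 1)} := Algebra.subset_adjoin (by simp)
    have h5 : x⁻¹ ∈ Algebra.adjoin k {x⁻¹, x, y * x⁻¹ ^ (g + 1)} := Algebra.subset_adjoin (by simp)
    have h6 : y * x⁻¹ ^ (g + 1) ∈ Algebra.adjoin k {x⁻¹, x, y * x⁻¹ ^ (g + 1)} :=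
      Algebra.subset_adjoin (by simp)
    apply le_antisymm <;> rw [Algebra.adjoin_le_iff]
    · rintro z (rfl | rfl | rfl)
      · exact h4
      · exact h5
      · have := mul_mem h6 (pow_mem h4 (g + 1))
        rwa [mul_assoc, ← mul_pow, inv_mul_cancel₀ hx, one_pow, mul_one] at this
    · rintro z (rfl | rfl | rfl)
      · exact h2
      · exact h1
      · exact mul_mem h3 (pow_mem h2 _)
  have hle (z w : F) : Algebra.adjoin k {z, w} ≤ Algebra.adjoin k {z, z⁻¹, w} :=
    Algebra.adjoin_mono (by
      rintro a (rfl | rfl) <;> simp)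
  exact
    { ne_zero := hx
      le₁ := hle _ _
      le₂ := hB ▸ hle _ _
      mem₁ := Algebra.subset_adjoin (by simp)
      mem₂ := Algebra.subset_adjoin (by simp)
      loc₁ := fun _ ↦ exists_mul_pow_mem_adjoin hx
      loc₂ := fun _ hb ↦ exists_mul_pow_mem_adjoin (inv_ne_zero hx) (hB ▸ hb)
      int₁ := fun _ ↦ isIntegral_of_mem_adjoin hy
      int₂ := fun _ ↦ isIntegral_of_mem_adjoin (sq_mul_inv_pow hx hy)
      fg₁ := Subalgebra.fg_def.2 ⟨_, by simp, rfl⟩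
      fg₂ := Subalgebra.fg_def.2 ⟨_, by simp, rfl⟩ }

variable [CharZero k]

/-- The coordinate ring of the affine curve `y² = c(x ^ N + 1)`. -/
theorem nonempty_algEquiv_adjoin {N : ℕ} (hx : Transcendental k x) (hc : c ≠ 0) (hN : N ≠ 0)
    (hy : y ^ 2 = algebraMap k F c * (x ^ N + 1)) :
    Nonempty (AdjoinRoot (doubleCoverPoly c N) ≃ₐ[k] Algebra.adjoin k {x, y}) :=
  ⟨(AlgEquiv.ofInjective _ (doubleCoverEval_injective hx hc hN hy)).trans
    (Subalgebra.equivOfEq _ _ (doubleCoverEval_range hy))⟩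

theorem locally_isStandardSmoothOfRelativeDimension_adjoin {N : ℕ} (hx : Transcendental k x)
    (hc : c ≠ 0) (hN : N ≠ 0) (hy : y ^ 2 = algebraMap k F c * (x ^ N + 1)) :
    RingHom.Locally (RingHom.IsStandardSmoothOfRelativeDimension 1)
      (algebraMap k (Algebra.adjoin k {x, y})) := by
  obtain ⟨e⟩ := nonempty_algEquiv_adjoin hx hc hN hy
  have := (RingHom.locally_respectsIso
    (RingHom.isStandardSmoothOfRelativeDimension_respectsIso (n := 1))).1 _ e.toRingEquiv
    (locally_isStandardSmoothOfRelativeDimension_doubleCover hc hN)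
  convert this
  ext r
  exact congr_arg Subtype.val (e.commutes r).symm

open TensorProduct in
theorem isDomain_tensorProduct_adjoin {N : ℕ} (hx : Transcendental k x)
    (hc : c ≠ 0) (hN : N ≠ 0) (hy : y ^ 2 = algebraMap k F c * (x ^ N + 1))
    (K : Type u) [Field K] [Algebra k K] : IsDomain (K ⊗[k] Algebra.adjoin k {x, y}) := by
  obtain ⟨e⟩ := nonempty_algEquiv_adjoin hx hc hN hy
  have := isDomain_tensorProduct_doubleCover hc hN K
  exact (Algebra.TensorProduct.congr (.refl (R := k) (A₁ := K)) e.symm).injective.isDomain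

theorem exists_smoothProperCurve_doubleCover (hx : Transcendental k x) (hc : c ≠ 0)
    (hy : y ^ 2 = algebraMap k F c * (x ^ (2 * g + 2) + 1)) :
    ∃ (Y : SmoothProperCurve k)
      (i₁ : Spec (CommRingCat.of (Algebra.adjoin k {x, y})) ⟶ Y.X)
      (i₂ : Spec (CommRingCat.of (Algebra.adjoin k {x⁻¹, y * x⁻¹ ^ (g + 1)})) ⟶ Y.X),
      IsGlueOf _ _ _ (isChartPair_doubleCover (ne_zero_of_transcendental hx) hy).le₁
        (isChartPair_doubleCover (ne_zero_of_transcendental hx) hy).le₂ Y.π i₁ i₂ := by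
  have hx0 := ne_zero_of_transcendental hx
  have h := isChartPair_doubleCover hx0 hy
  obtain ⟨X, π, i₁, i₂, H⟩ := h.exists_glue
  have hx' : Transcendental k x⁻¹ := fun h ↦ hx (by simpa using h.inv)
  have hy' := sq_mul_inv_pow hx0 hy
  have hN : 2 * g + 2 ≠ 0 := by omega
  exact ⟨
    { X := X
      π := π
      isIntegral := H.isIntegral h
      isProper := H.isProper h
      smooth := H.of_charts (P := @SmoothOfRelativeDimension.{u} 1)
        (locally_isStandardSmoothOfRelativeDimension_adjoin hx hc hN hy)
        (locally_isStandardSmoothOfRelativeDimension_adjoin hx' hc hN hy')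
      geometricallyConnected := H.geometricallyConnected
        (fun K _ _ ↦ isDomain_tensorProduct_adjoin hx hc hN hy K)
        (fun K _ _ ↦ isDomain_tensorProduct_adjoin hx' hc hN hy' K) }, i₁, i₂, H⟩

end Hyperelliptic

theorem isLocalization_of_ringEquiv {R S T : Type*} [CommRing R] [CommRing S] [CommRing T]
    {_ : Algebra R T} {M : Submonoid R} (h : IsLocalization M T) (e : T ≃+* S) (f : R →+* S)
    (hf : ∀ a, e (algebraMap R T a) = f a) :
    let := f.toAlgebra
    IsLocalization M S := by
  let := f.toAlgebra
  exact IsLocalization.isLocalization_of_algEquiv M { e with commutes' := hf }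

/-! ### Stalks of an affine chart as rings of fractions -/

section Chart

variable {X : Scheme.{u}} {A : Type u} [CommRing A] (i : Spec (CommRingCat.of A) ⟶ X)
  [IsOpenImmersion i]

theorem exists_ringHom_eq_fromSpecStalk {z : X} (hz : z ∈ Set.range i) :
    ∃ α : A →+* X.presheaf.stalk z,
      X.fromSpecStalk z = Spec.map (CommRingCat.ofHom α) ≫ i := by
  have : IsLocalRing (X.presheaf.stalk z) := X.toLocallyRingedSpace.isLocalRing z
  exact @exists_ringHom_of_closedPoint_mem_range X A (X.presheaf.stalk z) _ _ this
    (X.fromSpecStalk z) i _ (by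
      convert hz
      exact Scheme.fromSpecStalk_closedPoint)

/-- The local ring at a point of an affine open chart is a localisation of the coordinate ring. -/
theorem exists_isLocalization_stalk (p : Spec (CommRingCat.of A)) :
    ∃ α : A →+* X.presheaf.stalk (i p),
      X.fromSpecStalk (i p) = Spec.map (CommRingCat.ofHom α) ≫ i ∧
      let := α.toAlgebra
      let := PrimeSpectrum.isPrime p
      IsLocalization.AtPrime (X.presheaf.stalk (i p)) p.asIdeal := by
  obtain ⟨α, hα⟩ := exists_ringHom_eq_fromSpecStalk i ⟨p, rfl⟩
  refine ⟨α, hα, ?_⟩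
  have h := Scheme.SpecMap_stalkMap_fromSpecStalk (f := i) (x := p)
  rw [hα, Spec.fromSpecStalk_eq, ← Category.assoc, cancel_mono, ← Spec.map_comp] at h
  have h' := congr_arg CommRingCat.Hom.hom (Spec.map_injective h)
  let e := (asIso (i.stalkMap p)).commRingCatIsoToRingEquiv
  let := α.toAlgebra
  have : p.asIdeal.IsPrime := PrimeSpectrum.isPrime p
  exact isLocalization_of_ringEquiv (StructureSheaf.IsLocalization.to_stalk A p) e.symm α
    fun a ↦ e.symm_apply_eq.2 (RingHom.congr_fun h' a).symm

theorem surjective_algebraMap_stalk [IsIntegral X] {z : X} (hz : z = genericPoint X) :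
    Function.Surjective (algebraMap (X.presheaf.stalk z) X.functionField) := by
  subst hz
  intro q
  refine ⟨q, ?_⟩
  rw [RingHom.algebraMap_toAlgebra]
  have h := TopCat.Presheaf.stalkSpecializes_refl X.presheaf (genericPoint X)
  exact congr($h q)

theorem exists_ringHom_functionField [IsIntegral X] [IsDomain A] : ∃ α : A →+* X.functionField,
    X.fromSpecStalk (genericPoint X) = Spec.map (CommRingCat.ofHom α) ≫ i :=
  exists_ringHom_eq_fromSpecStalk i ⟨genericPoint _, genericPoint_eq_of_isOpenImmersion i⟩

variable {i} in
theorem mem_range_algebraMap_stalk_iff [IsIntegral X] [IsDomain A] {α : A →+* X.functionField}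
    (hα : X.fromSpecStalk (genericPoint X) = Spec.map (CommRingCat.ofHom α) ≫ i)
    (p : Spec (CommRingCat.of A)) :
    Function.Injective α ∧ ∀ q : X.functionField,
      q ∈ (algebraMap (X.presheaf.stalk (i p)) X.functionField).range ↔
        ∃ a, ∃ s ∉ p.asIdeal, q * α s = α a := by
  obtain ⟨β, hβ, hloc⟩ := exists_isLocalization_stalk i p
  let := β.toAlgebra
  have : p.asIdeal.IsPrime := PrimeSpectrum.isPrime p
  have hαβ : (algebraMap (X.presheaf.stalk (i p)) X.functionField).comp β = α := by
    have h := Scheme.SpecMap_stalkSpecializes_fromSpecStalk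
      ((genericPoint_spec X).specializes (trivial : i p ∈ _))
    rw [hβ, hα, ← Category.assoc, cancel_mono, ← Spec.map_comp] at h
    exact congr_arg CommRingCat.Hom.hom (Spec.map_injective h)
  have hinj : Function.Injective (algebraMap (X.presheaf.stalk (i p)) X.functionField) :=
    IsFractionRing.injective _ _
  have hinj' : Function.Injective β :=
    IsLocalization.injective (M := p.asIdeal.primeCompl) _ p.asIdeal.primeCompl_le_nonZeroDivisors
  refine ⟨hαβ ▸ hinj.comp hinj', fun q ↦ ⟨?_, ?_⟩⟩
  · rintro ⟨r, rfl⟩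
    obtain ⟨⟨a, s⟩, h⟩ := IsLocalization.surj p.asIdeal.primeCompl r
    refine ⟨a, s, s.2, ?_⟩
    rw [← hαβ]
    exact (map_mul _ _ _).symm.trans (congr_arg _ h)
  · rintro ⟨a, s, hs, h⟩
    obtain ⟨u, hu⟩ := IsLocalization.map_units (X.presheaf.stalk (i p))
      (⟨s, hs⟩ : p.asIdeal.primeCompl)
    have hu' : (u : X.presheaf.stalk (i p)) = β s := hu
    refine ⟨β a * (u⁻¹ : (X.presheaf.stalk (i p))ˣ), ?_⟩
    have h1 : algebraMap (X.presheaf.stalk (i p)) X.functionField (β a) =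
        q * algebraMap _ _ (β s) := by
      rw [← hαβ] at h
      exact h.symm
    rw [map_mul, h1, mul_assoc, ← map_mul, ← hu', u.mul_inv, map_one, mul_one]

end Chart

/-! ### The function field and the local rings of a gluing -/

section Glue

variable {k F : Type u} [Field k] [Field F] [Algebra k F] {A₁ A₂ B : Subalgebra k F} {x : F}

/-- The function field of a gluing of two charts. -/
theorem IsGlueOf.exists_functionField (Y : SmoothProperCurve k) (h : IsChartPair A₁ A₂ B x)
    {i₁ : Spec (CommRingCat.of A₁) ⟶ Y.X} {i₂ : Spec (CommRingCat.of A₂) ⟶ Y.X}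
    (H : IsGlueOf A₁ A₂ B h.le₁ h.le₂ Y.π i₁ i₂) :
    ∃ ι : Y.FunctionField →ₐ[k] F,
      (∀ b ∈ B, ∃ q, ι q = b) ∧
      (∀ q, ∃ a ∈ A₁, ∃ s ∈ A₁, s ≠ 0 ∧ ι q * s = a) ∧
      (∀ (p : Spec (CommRingCat.of A₁)) q, q ∈ Y.localRing (i₁ p) ↔
        ∃ a : A₁, ∃ s ∉ p.asIdeal, ι q * s = a) ∧
      (∀ (p : Spec (CommRingCat.of A₂)) q, q ∈ Y.localRing (i₂ p) ↔
        ∃ a : A₂, ∃ s ∉ p.asIdeal, ι q * s = a) := by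
  have := H.open₁
  have := H.open₂
  have := h.isOpenImmersion
  have : IsOpenImmersion (specInclusion h.le₁) := this
  obtain ⟨α₁, hα₁⟩ := exists_ringHom_functionField i₁
  obtain ⟨α₂, hα₂⟩ := exists_ringHom_functionField i₂
  -- The generic point lies in the overlap, so the two coordinate rings map to the function field
  -- through `B`.
  obtain ⟨β, hβ₁, hβ₂⟩ : ∃ β : B →+* Y.FunctionField,
      β.comp (Subalgebra.inclusion h.le₁).toRingHom = α₁ ∧
      β.comp (Subalgebra.inclusion h.le₂).toRingHom = α₂ := by
    have e := hα₁.symm.trans hα₂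
    obtain ⟨w, hw, -⟩ := H.overlap _ _ (congr($e (IsLocalRing.closedPoint Y.FunctionField)))
    obtain ⟨φ, hφ⟩ := exists_ringHom_of_closedPoint_mem_range (R := Y.FunctionField)
      (Spec.map (CommRingCat.ofHom α₁)) (specInclusion h.le₁) ⟨w, hw⟩
    refine ⟨φ, ?_, ?_⟩
    · rw [← Spec.map_comp] at hφ
      exact (congr_arg CommRingCat.Hom.hom (Spec.map_injective hφ)).symm
    · rw [hφ, Category.assoc, H.glue, ← Category.assoc, cancel_mono, ← Spec.map_comp] at e
      exact congr_arg CommRingCat.Hom.hom (Spec.map_injective e)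
  have hk (c : k) : β (algebraMap k B c) = algebraMap k Y.FunctionField c := by
    have h1 := Y.fromSpecStalk_comp_π (genericPoint Y.X)
    rw [hα₁, Category.assoc, H.over₁, ← Spec.map_comp] at h1
    have h2 := RingHom.congr_fun (congr_arg CommRingCat.Hom.hom (Spec.map_injective h1)) c
    rw [← hβ₁] at h2
    exact h2
  have hβ : Function.Injective β := by
    rw [injective_iff_map_eq_zero]
    intro b hb
    obtain ⟨n, hn⟩ := h.loc₁ b b.2
    have h1 : α₁ ⟨_, hn⟩ = 0 := by
      rw [← hβ₁]
      refine Eq.trans (congr_arg β (?_ : _ = b * ⟨x, h.le₁ h.mem₁⟩ ^ n)) ?_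
      · exact Subtype.ext rfl
      · rw [map_mul, hb, zero_mul]
    have h2 := (mem_range_algebraMap_stalk_iff hα₁ (genericPoint _)).1
      (h1.trans (map_zero α₁).symm)
    have h3 := congr_arg Subtype.val h2
    exact Subtype.ext ((mul_eq_zero.1 h3).resolve_right (pow_ne_zero n h.ne_zero))
  let := β.toAlgebra
  have hfrac₁ (q : Y.FunctionField) : ∃ a s : A₁, s ≠ 0 ∧ q * α₁ s = α₁ a := by
    have h1 := (mem_range_algebraMap_stalk_iff hα₁ (genericPoint _)).2 q
    obtain ⟨a, s, hs, e⟩ := h1.1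
      (surjective_algebraMap_stalk (genericPoint_eq_of_isOpenImmersion i₁) q)
    exact ⟨a, s, fun h0 ↦ hs (h0 ▸ zero_mem _), e⟩
  have hβα₁ (a : A₁) : β ⟨a, h.le₁ a.2⟩ = α₁ a := RingHom.congr_fun hβ₁ a
  have hβα₂ (a : A₂) : β ⟨a, h.le₂ a.2⟩ = α₂ a := RingHom.congr_fun hβ₂ a
  have hfrac : IsFractionRing B Y.FunctionField := by
    have : FaithfulSMul B Y.FunctionField := (faithfulSMul_iff_algebraMap_injective _ _).2 hβ
    refine IsFractionRing.of_field _ _ fun q ↦ ?_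
    obtain ⟨a, s, hs, e⟩ := hfrac₁ q
    refine ⟨⟨a, h.le₁ a.2⟩, ⟨s, h.le₁ s.2⟩, ?_⟩
    have hs' : α₁ s ≠ 0 := by
      rw [← hβα₁, map_ne_zero_iff _ hβ]
      exact fun h0 ↦ hs (Subtype.ext (id (Subtype.ext_iff.1 h0 : (s : F) = ((0 : B) : F))))
    refine eq_div_of_mul_eq (?_ : β _ ≠ 0) (?_ : q * β _ = β _)
    · rwa [hβα₁]
    · rwa [hβα₁, hβα₁]
  -- The function field is the fraction field of `B`, so the inclusion of `B` in `F` extends to it.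
  let ι₀ : Y.FunctionField →+* F := IsFractionRing.lift (g := B.val.toRingHom) Subtype.val_injective
  have hι (b : B) : ι₀ (β b) = b := IsFractionRing.lift_algebraMap (g := B.val.toRingHom) _ b
  have hι₁ (a : A₁) : ι₀ (α₁ a) = a := by rw [← hβα₁, hι]
  have hι₂ (a : A₂) : ι₀ (α₂ a) = a := by rw [← hβα₂, hι]
  refine ⟨{ ι₀ with commutes' := fun c ↦ ?_ }, fun b hb ↦ ⟨β ⟨b, hb⟩, hι _⟩, fun q ↦ ?_,
    fun p q ↦ ?_, fun p q ↦ ?_⟩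
  · refine Eq.trans (congr_arg ι₀ (hk c).symm) (hι _)
  · obtain ⟨a, s, hs, e⟩ := hfrac₁ q
    refine ⟨a, a.2, s, s.2, fun h0 ↦ hs (Subtype.ext h0), ?_⟩
    rw [← hι₁ a, ← e, map_mul, hι₁]
    rfl
  · refine ((mem_range_algebraMap_stalk_iff hα₁ p).2 q).trans ?_
    refine exists_congr fun a ↦ exists_congr fun s ↦ and_congr_right fun _ ↦ ?_
    rw [← ι₀.injective.eq_iff, map_mul, hι₁, hι₁]
    rfl
  · refine ((mem_range_algebraMap_stalk_iff hα₂ p).2 q).trans ?_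
    refine exists_congr fun a ↦ exists_congr fun s ↦ and_congr_right fun _ ↦ ?_
    rw [← ι₀.injective.eq_iff, map_mul, hι₂, hι₂]
    rfl

end Glue

/-- A subalgebra of a field is the intersection of its localisations. -/
theorem Subalgebra.mem_iff_forall_primeSpectrum {k F : Type*} [Field k] [Field F] [Algebra k F]
    (A : Subalgebra k F) (f : F) :
    f ∈ A ↔ ∀ p : PrimeSpectrum A, ∃ a : A, ∃ s ∉ p.asIdeal, f * s = a := by
  refine ⟨fun hf p ↦ ⟨⟨f, hf⟩, 1, (Ideal.ne_top_iff_one _).1 p.isPrime.ne_top, mul_one f⟩,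
    fun h ↦ ?_⟩
  -- This is the ideal of denominators of `f`; it lies in no maximal ideal, as `f` is a fraction at
  -- each of them.
  let I : Ideal A :=
    { carrier := {s | f * s ∈ A}
      add_mem' := fun {s t} hs ht ↦ by
        have := A.add_mem hs ht
        rwa [← mul_add] at this
      zero_mem' := by
        change f * ((0 : A) : F) ∈ A
        simp
      smul_mem' := fun r s hs ↦ by
        have := A.mul_mem r.2 hs
        rwa [mul_left_comm] at this }
  by_contra hf
  have hI : I ≠ ⊤ := fun hI ↦ hf (by
    have h1 : f * ((1 : A) : F) ∈ A := (Ideal.eq_top_iff_one I).1 hI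
    rwa [OneMemClass.coe_one, mul_one] at h1)
  obtain ⟨m, hm, hIm⟩ := I.exists_le_maximal hI
  obtain ⟨a, s, hs, e⟩ := h ⟨m, hm.isPrime⟩
  exact hs (hIm (by
    change f * (s : F) ∈ A
    exact e ▸ a.2))

/-! ### Regular differentials on the affine hyperelliptic curve -/

section Differential

variable {k E : Type*} [Field k] [Field E] [Algebra k E] {x y : E} {c : k} {N : ℕ}

/-- The differential `dx / y` in terms of the coordinates at infinity. -/
theorem inv_mul_smul_D_inv {g : ℕ} (hg : 1 ≤ g) (hx0 : x ≠ 0) :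
    (y * x⁻¹ ^ (g + 1))⁻¹ • KaehlerDifferential.D k E x⁻¹ =
      (-x ^ (g - 1)) • y⁻¹ • KaehlerDifferential.D k E x := by
  obtain ⟨g, rfl⟩ := Nat.exists_eq_add_of_le' hg
  rw [Derivation.leibniz_inv, smul_smul, smul_smul]
  congr 1
  simp only [Nat.add_sub_cancel, mul_inv, inv_pow, inv_inv]
  field_simp
  ring

variable [CharZero k]

theorem D_eq_smul_of_sq_eq (hy : y ^ 2 = algebraMap k E c * (x ^ N + 1)) (hy0 : y ≠ 0) :
    KaehlerDifferential.D k E y =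
      (algebraMap k E (c * N / 2) * x ^ (N - 1)) • y⁻¹ • KaehlerDifferential.D k E x := by
  have : CharZero E := charZero_of_injective_algebraMap (algebraMap k E).injective
  have h := congr_arg (KaehlerDifferential.D k E) hy
  simp only [Derivation.leibniz_pow, Derivation.leibniz, Derivation.map_algebraMap, map_add,
    Derivation.map_one_eq_zero, smul_zero, add_zero, ← Nat.cast_smul_eq_nsmul E, smul_smul] at h
  have h2 : (2 * y : E) ≠ 0 := mul_ne_zero two_ne_zero hy0
  have h3 : KaehlerDifferential.D k E y = (2 * y)⁻¹ • ((2 * y) • KaehlerDifferential.D k E y) := by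
    rw [smul_smul, inv_mul_cancel₀ h2, one_smul]
  have h4 : (2 * y) • KaehlerDifferential.D k E y =
      (algebraMap k E c * ((N : E) * x ^ (N - 1))) • KaehlerDifferential.D k E x := by
    convert h using 2
    simp
  rw [h3, h4, smul_smul, smul_smul]
  congr 1
  simp only [map_div₀, map_mul, map_natCast, map_ofNat]
  field_simp

/-- The differentials of an algebra of fractions of `k[x, y]`, where `y² = c(x ^ N + 1)`, are the
multiples of `dx / y`. -/
theorem mem_span_differentials_iff (hy : y ^ 2 = algebraMap k E c * (x ^ N + 1)) (hc : c ≠ 0)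
    (hN : N ≠ 0) (hy0 : y ≠ 0) (O : Subring E)
    (hO : ∀ a ∈ Algebra.adjoin k {x, y}, a ∈ O)
    (hfrac : ∀ b ∈ O, ∃ s ∈ Algebra.adjoin k {x, y},
      s ≠ 0 ∧ s⁻¹ ∈ O ∧ b * s ∈ Algebra.adjoin k {x, y}) (η : Ω[E⁄k]) :
    η ∈ Submodule.span k {ω | ∃ a ∈ O, ∃ b ∈ O, ω = a • KaehlerDifferential.D k E b} ↔
      ∃ f ∈ O, η = f • y⁻¹ • KaehlerDifferential.D k E x := by
  have hDx : KaehlerDifferential.D k E x = y • y⁻¹ • KaehlerDifferential.D k E x := by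
    rw [smul_smul, mul_inv_cancel₀ hy0, one_smul]
  have hDy := D_eq_smul_of_sq_eq hy hy0
  generalize y⁻¹ • KaehlerDifferential.D k E x = ω at hDx hDy ⊢
  have hxA : x ∈ Algebra.adjoin k {x, y} := Algebra.subset_adjoin (by simp)
  have hyA : y ∈ Algebra.adjoin k {x, y} := Algebra.subset_adjoin (by simp)
  have hkA (r : k) : algebraMap k E r ∈ Algebra.adjoin k {x, y} := Subalgebra.algebraMap_mem _ r
  have hA : ∀ a ∈ Algebra.adjoin k {x, y}, ∃ f ∈ Algebra.adjoin k {x, y},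
      KaehlerDifferential.D k E a = f • ω := by
    intro a ha
    induction ha using Algebra.adjoin_induction with
    | mem z hz =>
      obtain rfl | rfl : z = x ∨ z = y := hz
      · exact ⟨y, hyA, hDx⟩
      · exact ⟨_, mul_mem (hkA _) (pow_mem hxA _), hDy⟩
    | algebraMap r => exact ⟨0, zero_mem _, by simp⟩
    | add a b _ _ ha hb =>
      obtain ⟨f, hf, h₁⟩ := ha
      obtain ⟨f', hf', h₂⟩ := hb
      exact ⟨f + f', add_mem hf hf', by rw [map_add, h₁, h₂, add_smul]⟩
    | mul a b ha' hb' ha hb =>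
      obtain ⟨f, hf, h₁⟩ := ha
      obtain ⟨f', hf', h₂⟩ := hb
      exact ⟨a * f' + b * f, add_mem (mul_mem ha' hf') (mul_mem hb' hf), by
        rw [Derivation.leibniz, h₁, h₂, add_smul, smul_smul, smul_smul]⟩
  constructor
  · intro h
    induction h using Submodule.span_induction with
    | mem η h =>
      obtain ⟨a, ha, b, hb, rfl⟩ := h
      obtain ⟨s, hs, hs0, hs', hbs⟩ := hfrac b hb
      obtain ⟨f, hf, h₁⟩ := hA s hs
      obtain ⟨f', hf', h₂⟩ := hA _ hbs
      rw [Derivation.leibniz, h₁, smul_smul] at h₂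
      -- The quotient rule `db = s⁻¹(d(bs) - b ds)` reduces to elements of `k[x, y]`.
      refine ⟨a * (s⁻¹ * (f' - b * f)), O.mul_mem ha (O.mul_mem hs' (O.sub_mem (hO _ hf')
        (O.mul_mem hb (hO _ hf)))), ?_⟩
      rw [mul_smul, mul_smul, sub_smul, ← h₂, add_sub_cancel_left, smul_smul s⁻¹ s,
        inv_mul_cancel₀ hs0, one_smul]
    | zero => exact ⟨0, O.zero_mem, (zero_smul _ _).symm⟩
    | add η η' _ _ h h' =>
      obtain ⟨f, hf, rfl⟩ := h
      obtain ⟨f', hf', rfl⟩ := h'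
      exact ⟨f + f', O.add_mem hf hf', (add_smul _ _ _).symm⟩
    | smul r η _ h =>
      obtain ⟨f, hf, rfl⟩ := h
      refine ⟨algebraMap k E r * f, O.mul_mem (hO _ (hkA r)) hf, ?_⟩
      rw [mul_smul, algebraMap_smul]
  · rintro ⟨f, hf, rfl⟩
    -- With `ω = dx / y`, the terms are `c⁻¹ y dx = (x^N + 1) ω` and `(2 / (cN)) x dy = x^N ω`;
    -- their difference is `ω`.
    have h1 : f • ω = (f * algebraMap k E c⁻¹ * y) • KaehlerDifferential.D k E x -
        (f * algebraMap k E (c⁻¹ * (2 / N)) * x) • KaehlerDifferential.D k E y := by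
      have : CharZero E := charZero_of_injective_algebraMap (algebraMap k E).injective
      rw [hDy, hDx, smul_smul, smul_smul, ← sub_smul]
      congr 1
      have hc' : algebraMap k E c ≠ 0 := by simpa using hc
      have hN' : (N : E) ≠ 0 := by simpa using hN
      have h2 : x ^ N = x * x ^ (N - 1) := by rw [← pow_succ', Nat.sub_add_cancel (by omega)]
      have h3 : f * algebraMap k E c⁻¹ * y * y = f * (algebraMap k E c⁻¹ * y ^ 2) := by ring
      rw [h3, hy]
      simp only [map_div₀, map_mul, map_natCast, map_ofNat, map_inv₀]
      rw [h2]
      field_simp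
      ring
    rw [h1]
    refine sub_mem (Submodule.subset_span ⟨_, ?_, _, hO _ hxA, rfl⟩)
      (Submodule.subset_span ⟨_, ?_, _, hO _ hyA, rfl⟩)
    · exact O.mul_mem (O.mul_mem hf (hO _ (hkA _))) (hO _ hyA)
    · exact O.mul_mem (O.mul_mem hf (hO _ (hkA _))) (hO _ hxA)

variable {F : Type*} [Field F] [Algebra k F] {ι : E →ₐ[k] F} {x' y' : F}

/-- The differentials that are regular on the affine curve `y² = c(x ^ N + 1)`. -/
theorem forall_mem_span_differentials_iff (hy : y ^ 2 = algebraMap k E c * (x ^ N + 1))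
    (hc : c ≠ 0) (hN : N ≠ 0) (hy0 : y ≠ 0) (hω : KaehlerDifferential.D k E x ≠ 0)
    (hx' : ι x = x') (hy' : ι y = y')
    {O : PrimeSpectrum (Algebra.adjoin k {x', y'}) → Subring E}
    (hO : ∀ p q, q ∈ O p ↔ ∃ a : Algebra.adjoin k {x', y'}, ∃ s ∉ p.asIdeal, ι q * s = a)
    (η : Ω[E⁄k]) :
    (∀ p, η ∈ Submodule.span k {ω | ∃ a ∈ O p, ∃ b ∈ O p, ω = a • KaehlerDifferential.D k E b}) ↔
      ∃ f, ι f ∈ Algebra.adjoin k {x', y'} ∧ η = f • y⁻¹ • KaehlerDifferential.D k E x := by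
  have hmap : (Algebra.adjoin k {x, y}).map ι = Algebra.adjoin k {x', y'} := by
    rw [AlgHom.map_adjoin, Set.image_pair, hx', hy']
  have hspan p :
      η ∈ Submodule.span k {ω | ∃ a ∈ O p, ∃ b ∈ O p, ω = a • KaehlerDifferential.D k E b} ↔
      ∃ f ∈ O p, η = f • y⁻¹ • KaehlerDifferential.D k E x := by
    have h1 : (1 : Algebra.adjoin k {x', y'}) ∉ p.asIdeal :=
      (Ideal.ne_top_iff_one _).1 p.isPrime.ne_top
    refine mem_span_differentials_iff hy hc hN hy0 (O p) (fun a ha ↦ ?_) (fun b hb ↦ ?_) η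
    · exact (hO p a).2 ⟨⟨ι a, hmap ▸ ⟨a, ha, rfl⟩⟩, 1, h1, mul_one _⟩
    · obtain ⟨a, s, hs, e⟩ := (hO p b).1 hb
      obtain ⟨s', hs', e'⟩ : (s : F) ∈ (Algebra.adjoin k {x, y}).map ι := by
        rw [hmap]
        exact s.2
      obtain ⟨a', ha', ea⟩ : (a : F) ∈ (Algebra.adjoin k {x, y}).map ι := by
        rw [hmap]
        exact a.2
      replace e' : ι s' = s := e'
      replace ea : ι a' = a := ea
      have hs0 : s' ≠ 0 := by
        rintro rfl
        refine hs ?_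
        have : s = 0 := Subtype.ext (e'.symm.trans (map_zero ι))
        exact this ▸ zero_mem _
      refine ⟨s', hs', hs0, (hO p _).2 ⟨1, s, hs, ?_⟩, ?_⟩
      · rw [← e', ← map_mul, inv_mul_cancel₀ hs0, map_one]
        rfl
      · have : b * s' = a' := ι.injective
          ((map_mul ι b s').trans ((by rw [e', e] : _ = (a : F)).trans ea.symm))
        rwa [this]
  simp only [hspan]
  have hω' : y⁻¹ • KaehlerDifferential.D k E x ≠ 0 := smul_ne_zero (inv_ne_zero hy0) hω
  constructor
  · intro h
    -- The generic point supplies a coefficient. It is unique because `dx / y` is nonzero, so it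
    -- lies in every local ring and hence in the coordinate ring.
    obtain ⟨f, -, hf⟩ := h ⟨⊥, Ideal.isPrime_bot⟩
    refine ⟨f, (Subalgebra.mem_iff_forall_primeSpectrum _ _).2 fun p ↦ (hO p f).1 ?_, hf⟩
    obtain ⟨f', hf', e⟩ := h p
    rwa [smul_left_injective E hω'
      (hf.symm.trans e :
        f • y⁻¹ • KaehlerDifferential.D k E x = f' • y⁻¹ • KaehlerDifferential.D k E x)]
  · rintro ⟨f, hf, e⟩ p
    exact ⟨f, (hO p f).2 ((Subalgebra.mem_iff_forall_primeSpectrum _ _).1 hf p), e⟩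

end Differential

/-! ### Functions with bounded poles at infinity -/

section Polynomial

open Polynomial

variable {k F : Type u} [Field k] [Field F] [Algebra k F] {x y : F} {c : k} {g : ℕ}

theorem exists_aeval_eq_of_mem_adjoin {N : ℕ} (hy : y ^ 2 = algebraMap k F c * (x ^ N + 1)) {a : F}
    (ha : a ∈ Algebra.adjoin k {x, y}) : ∃ p q : k[X], a = aeval x p + aeval x q * y := by
  induction ha using Algebra.adjoin_induction with
  | mem z hz =>
    obtain rfl | rfl : z = x ∨ z = y := hz
    · exact ⟨X, 0, by simp⟩
    · exact ⟨0, 1, by simp⟩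
  | algebraMap r => exact ⟨C r, 0, by simp⟩
  | add a b _ _ ha hb =>
    obtain ⟨p, q, rfl⟩ := ha
    obtain ⟨p', q', rfl⟩ := hb
    exact ⟨p + p', q + q', by simp only [map_add]; ring⟩
  | mul a b _ _ ha hb =>
    obtain ⟨p, q, rfl⟩ := ha
    obtain ⟨p', q', rfl⟩ := hb
    refine ⟨p * p' + q * q' * (C c * (X ^ N + 1)), p * q' + p' * q, ?_⟩
    simp only [map_add, map_mul, aeval_C, map_pow, aeval_X, map_one]
    linear_combination (aeval x q * aeval x q') * hy

theorem aeval_inv_mul_pow (hx : x ≠ 0) {p : k[X]} {n : ℕ} (hp : p.natDegree ≤ n) :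
    aeval x⁻¹ p * x ^ n = aeval x (p.reflect n) := by
  let := invertibleOfNonzero (inv_ne_zero hx)
  have h := eval₂_reflect_mul_pow (algebraMap k F) x⁻¹ n p hp
  rw [invOf_eq_inv, inv_inv] at h
  rw [aeval_def, aeval_def, ← h, mul_assoc, ← mul_pow, inv_mul_cancel₀ hx, one_pow, mul_one]

/-- The functions on `y² = c(x ^ (2g + 2) + 1)` without poles outside infinity, and with poles of
order at most `g - 1` there, are the polynomials in `x` of degree less than `g`. -/
theorem mem_adjoin_and_mul_mem_adjoin_iff [CharZero k] (hx : Transcendental k x) (hc : c ≠ 0)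
    (hg : 1 ≤ g) (hy : y ^ 2 = algebraMap k F c * (x ^ (2 * g + 2) + 1)) (f : F) :
    (f ∈ Algebra.adjoin k {x, y} ∧
      f * x⁻¹ ^ (g - 1) ∈ Algebra.adjoin k {x⁻¹, y * x⁻¹ ^ (g + 1)}) ↔
    ∃ p ∈ degreeLT k g, f = aeval x p := by
  have hx0 := ne_zero_of_transcendental hx
  constructor
  · rintro ⟨h₁, h₂⟩
    obtain ⟨a, b, rfl⟩ := exists_aeval_eq_of_mem_adjoin hy h₁
    obtain ⟨p, q, e⟩ := exists_aeval_eq_of_mem_adjoin (sq_mul_inv_pow hx0 hy) h₂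
    have hp := aeval_inv_mul_pow hx0
      (show p.natDegree ≤ p.natDegree + q.natDegree + (g + 1) by omega)
    have hq := aeval_inv_mul_pow hx0 (show q.natDegree ≤ p.natDegree + q.natDegree by omega)
    have hpd := p.natDegree_reflect_le (N := p.natDegree + q.natDegree + (g + 1))
    have hqd := q.natDegree_reflect_le (N := p.natDegree + q.natDegree)
    rw [max_eq_left (by omega)] at hpd hqd
    set n := p.natDegree + q.natDegree
    -- Multiplying `e` by `x^(n+g+1)` clears all negative powers, and the coefficients of `1` and
    -- `y` can be compared. The degree bound `n` on `b X^(n+2)` forces `b = 0`; the bound `n + g +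
    -- 1` on `a X^(n+2)` gives `deg a ≤ g - 1`.
    have key := eq_zero_of_aeval_add_aeval_mul_eq_zero (k := k)
      (a := a * X ^ (n + 2) - p.reflect (n + (g + 1))) (b := b * X ^ (n + 2) - q.reflect n)
      hx hc (by omega) hy (by
        simp only [map_sub, map_mul, map_pow, aeval_X, ← hp, ← hq]
        have h1 : x⁻¹ ^ (g - 1) * x ^ (n + (g + 1)) = x ^ (n + 2) := by
          rw [show n + (g + 1) = (g - 1) + (n + 2) by omega, pow_add, ← mul_assoc, ← mul_pow,
            inv_mul_cancel₀ hx0, one_pow, one_mul]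
        have h2 : x⁻¹ ^ (g + 1) * x ^ (n + (g + 1)) = x ^ n := by
          rw [pow_add x, mul_comm (x ^ n), ← mul_assoc, ← mul_pow,
            inv_mul_cancel₀ hx0, one_pow, one_mul]
        linear_combination x ^ (n + (g + 1)) * e - (aeval x a + aeval x b * y) * h1 +
          aeval x⁻¹ q * y * h2)
    have ha : a * X ^ (n + 2) = p.reflect (n + (g + 1)) := sub_eq_zero.1 key.1
    have hb : b * X ^ (n + 2) = q.reflect n := sub_eq_zero.1 key.2
    have hb0 : b = 0 := by
      by_contra h0
      rw [← hb, natDegree_mul_X_pow _ h0] at hqd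
      omega
    refine ⟨a, ?_, by simp [hb0]⟩
    rw [mem_degreeLT]
    by_cases h0 : a = 0
    · simp [h0]
    · rw [← ha, natDegree_mul_X_pow _ h0] at hpd
      rw [degree_eq_natDegree h0, Nat.cast_lt]
      omega
  · rintro ⟨p, hp, rfl⟩
    have hdeg : p.natDegree ≤ g - 1 := by
      by_cases h0 : p = 0
      · simp [h0]
      · rw [mem_degreeLT, degree_eq_natDegree h0, Nat.cast_lt] at hp
        omega
    refine ⟨Algebra.adjoin_mono (by simp) (aeval_mem_adjoin_singleton k x), ?_⟩
    have h := aeval_inv_mul_pow (inv_ne_zero hx0) hdeg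
    rw [inv_inv] at h
    rw [h]
    exact Algebra.adjoin_mono (by simp) (aeval_mem_adjoin_singleton k x⁻¹)

end Polynomial

/-! ### The genus of the hyperelliptic curve -/

namespace SmoothProperCurve

open Polynomial

theorem exists_D_ne_zero {k : Type u} [Field k] (C : SmoothProperCurve k) :
    ∃ q : C.FunctionField, KaehlerDifferential.D k C.FunctionField q ≠ 0 := by
  obtain ⟨-, ⟨b⟩⟩ := C.essFiniteType_and_exists_basis_kaehlerDifferential (genericPoint C.X)
  let b' : Module.Basis Unit C.FunctionField Ω[C.FunctionField⁄k] := b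
  by_contra! h
  have h1 := KaehlerDifferential.span_range_derivation k C.FunctionField
  have h2 : Set.range (KaehlerDifferential.D k C.FunctionField) ⊆ {0} := by
    rintro _ ⟨q, rfl⟩
    exact h q
  have h3 := Submodule.span_mono (R := C.FunctionField) h2
  rw [h1, Submodule.span_zero_singleton] at h3
  exact b'.ne_zero () ((Submodule.mem_bot _).1 (h3 trivial))

/-- The smooth projective model of `y² = c(x ^ (2g + 2) + 1)`, a hyperelliptic curve of
genus `g`. -/
theorem exists_genus_eq_and_fieldRange_eq {k F : Type u} [Field k] [CharZero k] [Field F]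
    [Algebra k F] {x y : F} (hx : Transcendental k x) {g : ℕ} (hg : 1 ≤ g) {c : k} (hc : c ≠ 0)
    (hy : y ^ 2 = algebraMap k F c * (x ^ (2 * g + 2) + 1)) :
    ∃ (Y : SmoothProperCurve k) (ι : Y.FunctionField →ₐ[k] F),
      Y.genus = g ∧ ι.fieldRange = IntermediateField.adjoin k {x, y} := by
  have hx0 := ne_zero_of_transcendental hx
  have hN : 2 * g + 2 ≠ 0 := by omega
  have hy0 : y ≠ 0 := by
    rintro rfl
    have h := (eq_zero_of_aeval_add_aeval_mul_eq_zero (a := 0) (b := 1) hx hc hN hy (by simp)).2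
    exact one_ne_zero h
  obtain ⟨Y, i₁, i₂, H⟩ := exists_smoothProperCurve_doubleCover hx hc hy
  obtain ⟨ι, hB, hfrac, h₁, h₂⟩ := H.exists_functionField Y (isChartPair_doubleCover hx0 hy)
  refine ⟨Y, ι, ?_, ?_⟩
  · obtain ⟨x', hx'⟩ := hB x (Algebra.subset_adjoin (by simp))
    obtain ⟨y', hy'⟩ := hB y (Algebra.subset_adjoin (by simp))
    have hx0' : x' ≠ 0 := by
      rintro rfl
      exact hx0 (by rw [← hx', map_zero])
    have hy0' : y' ≠ 0 := by
      rintro rfl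
      exact hy0 (by rw [← hy', map_zero])
    have hyE : y' ^ 2 = algebraMap k Y.FunctionField c * (x' ^ (2 * g + 2) + 1) := ι.injective (by
      simpa [hx', hy'] using hy)
    let D := KaehlerDifferential.D k Y.FunctionField
    -- Taking the whole function field for the ring `O`, every differential is a multiple of `dx /
    -- y`, so `dx = 0` would kill them all.
    have hDx : D x' ≠ 0 := by
      intro h0
      obtain ⟨q, hq⟩ := Y.exists_D_ne_zero
      refine hq ?_
      have hmap : (Algebra.adjoin k {x', y'}).map ι = Algebra.adjoin k {x, y} := by
        rw [AlgHom.map_adjoin, Set.image_pair, hx', hy']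
      obtain ⟨f, -, hf⟩ := (mem_span_differentials_iff hyE hc hN hy0' ⊤ (fun _ _ ↦ trivial)
        (fun b _ ↦ by
          obtain ⟨a, ha, s, hs, hs0, e⟩ := hfrac b
          rw [← hmap] at ha hs
          obtain ⟨a, ha, rfl⟩ := ha
          obtain ⟨s, hs, rfl⟩ := hs
          have e' : b * s = a := ι.injective ((map_mul ι b s).trans e)
          refine ⟨s, hs, ?_, trivial, e' ▸ ha⟩
          rintro rfl
          exact hs0 (map_zero ι)) (D q)).1 (Submodule.subset_span ⟨1, trivial, q, trivial,
            (one_smul _ _).symm⟩)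
      exact hf.trans (by rw [show KaehlerDifferential.D k Y.FunctionField x' = 0 from h0,
        smul_zero, smul_zero])
    set ω := y'⁻¹ • D x' with hω
    have hω0 : ω ≠ 0 := smul_ne_zero (inv_ne_zero hy0') hDx
    have hinv := inv_mul_smul_D_inv (k := k) (y := y') hg hx0'
    have hpow : x' ^ (g - 1) * x'⁻¹ ^ (g - 1) = 1 := by
      rw [← mul_pow, mul_inv_cancel₀ hx0', one_pow]
    have hw₁ η := forall_mem_span_differentials_iff hyE hc hN hy0' hDx hx' hy' h₁ η
    have hw₂ η := forall_mem_span_differentials_iff (sq_mul_inv_pow hx0' hyE) hc hN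
      (mul_ne_zero hy0' (pow_ne_zero _ (inv_ne_zero hx0')))
      (fun h0 ↦ by
        rw [h0, smul_zero] at hinv
        exact smul_ne_zero (neg_ne_zero.2 (pow_ne_zero _ hx0')) hω0 hinv.symm)
      ((map_inv₀ ι x').trans (by rw [hx']))
      (show ι (y' * x'⁻¹ ^ (g + 1)) = y * x⁻¹ ^ (g + 1) by simp [hx', hy']) h₂ η
    let Φ : k[X] →ₗ[k] Ω[Y.FunctionField⁄k] :=
      (LinearMap.toSpanSingleton Y.FunctionField _ ω).restrictScalars k ∘ₗ (aeval x').toLinearMap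
    have hΦ (p) : Φ p = aeval x' p • ω := rfl
    have hι (p : k[X]) : ι (aeval x' p) = aeval x p := by rw [← hx', aeval_algHom_apply]
    have hΦinj : Function.Injective Φ := by
      intro p q h
      have h3 : aeval x' p = aeval x' q := smul_left_injective _ hω0 h
      have h4 : aeval x p = aeval x q := by rw [← hι, h3, hι]
      exact transcendental_iff_injective.1 hx h4
    have hglob : Y.globalDifferentials = (degreeLT k g).map Φ := by
      ext η
      have h3 : η ∈ Y.globalDifferentials ↔
          (∀ p, η ∈ Y.differentialsRegularAt (i₁ p)) ∧
            ∀ p, η ∈ Y.differentialsRegularAt (i₂ p) := by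
        rw [globalDifferentials, Submodule.mem_iInf]
        refine ⟨fun h ↦ ⟨fun p ↦ h _, fun p ↦ h _⟩, fun h z ↦ ?_⟩
        obtain ⟨p, rfl⟩ | ⟨p, rfl⟩ := H.cover z
        exacts [h.1 p, h.2 p]
      rw [h3]
      refine (and_congr (hw₁ η) (hw₂ η)).trans ?_
      -- The generator at infinity is `-x^(g-1) dx / y`. So `f dx / y` is regular there exactly when
      -- `f x^(-(g-1))` belongs to the second coordinate ring.
      rw [hinv]
      constructor
      · rintro ⟨⟨f, hf, rfl⟩, f', hf', e⟩
        rw [smul_smul f'] at e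
        have e1 : f = f' * -x' ^ (g - 1) := smul_left_injective _ hω0 e
        have e2 : f * x'⁻¹ ^ (g - 1) = - f' := by
          rw [e1, mul_assoc, neg_mul, hpow, mul_neg, mul_one]
        have e3 : ι f * x⁻¹ ^ (g - 1) = - ι f' := by
          rw [← map_neg, ← e2, map_mul, map_pow, map_inv₀, hx']
        obtain ⟨p, hp, e4⟩ := (mem_adjoin_and_mul_mem_adjoin_iff hx hc hg hy (ι f)).1
          ⟨hf, e3 ▸ neg_mem hf'⟩
        rw [← hι] at e4
        exact ⟨p, hp, by rw [hΦ, ι.injective e4]⟩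
      · rintro ⟨p, hp, rfl⟩
        obtain ⟨h3, h4⟩ := (mem_adjoin_and_mul_mem_adjoin_iff hx hc hg hy _).2 ⟨p, hp, rfl⟩
        rw [← hι] at h3 h4
        refine ⟨⟨_, h3, rfl⟩, -(aeval x' p * x'⁻¹ ^ (g - 1)), ?_, ?_⟩
        · rw [map_neg, map_mul, map_pow, map_inv₀, hx']
          exact neg_mem h4
        · rw [smul_smul, neg_mul_neg, mul_assoc, mul_comm (x'⁻¹ ^ _), hpow, mul_one, hΦ]
    rw [genus, hglob, ← (Submodule.equivMapOfInjective Φ hΦinj _).finrank_eq,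
      (degreeLTEquiv k g).finrank_eq, Module.finrank_fin_fun]
  · apply le_antisymm
    · rintro _ ⟨q, rfl⟩
      obtain ⟨a, ha, s, hs, hs0, e⟩ := hfrac q
      have hle := IntermediateField.algebra_adjoin_le_adjoin k {x, y}
      have e' : ι q = a / s := eq_div_of_mul_eq hs0 e
      exact (e' ▸ div_mem (hle ha) (hle hs) : ι q ∈ IntermediateField.adjoin k {x, y})
    · rw [IntermediateField.adjoin_le_iff]
      rintro z (rfl | rfl)
      all_goals exact hB _ (Algebra.subset_adjoin (by simp))

end SmoothProperCurve

/-! ### Changing the curve, and the conclusion -/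

namespace GaloisSection

variable {k K Ω : Type u} [Field k] [Field K] [Field Ω] [Algebra k K] [Algebra K Ω] [Algebra k Ω]
  [IsScalarTower k K Ω] [CharZero k] [IsAlgClosed Ω]

/-- If a curve satisfies the section conjecture and its function field embeds in a field of elements
fixed by a Galois section, then the section has a stable place, and all of its stable places have
the same restriction to the function field of the curve. -/
theorem exists_isStablePlace_of_bgasc [Algebra.IsIntegral K Ω] (s : GaloisSection k K Ω)
    {Y : SmoothProperCurve k}
    (hY : Y.BGASC) (ι : Y.FunctionField →ₐ[k] Ω) (hι : ∀ τ a, s.toHom τ (ι a) = ι a)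
    (halg : ∀ z : Ω, IsAlgebraic ι.fieldRange z) :
    (∃ V, s.IsStablePlace V) ∧ ∀ V V', s.IsStablePlace V → s.IsStablePlace V' →
      ∀ a, ι a ∈ V → ι a ∈ V' := by
  let := ι.toRingHom.toAlgebra
  have : IsScalarTower k Y.FunctionField Ω := .of_algebraMap_eq fun c ↦ (ι.commutes c).symm
  have : Algebra.IsAlgebraic Y.FunctionField Ω := by
    refine ⟨fun z ↦ ?_⟩
    obtain ⟨p, hp, hpz⟩ := halg z
    let e := AlgEquiv.ofInjectiveField ι
    let f : ι.fieldRange →+* Y.FunctionField := e.symm.toRingEquiv.toRingHom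
    refine ⟨p.map f, (Polynomial.map_ne_zero_iff f.injective).2 hp, ?_⟩
    rw [Polynomial.aeval_def, Polynomial.eval₂_map]
    refine Eq.trans (congr_arg (fun f ↦ Polynomial.eval₂ f z p) ?_) hpz
    ext b
    exact congr_arg Subtype.val (e.apply_symm_apply b)
  have : CharZero Y.FunctionField := charZero_of_injective_algebraMap (algebraMap k _).injective
  have : IsAlgClosure Y.FunctionField Ω := ⟨inferInstance, inferInstance⟩
  -- `Ω` is algebraically closed and algebraic over the function field of `Y`, so it also serves as
  -- the separable closure of that field, and `s` becomes a section for `Y`.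
  let e₀ : Y.SepClosure ≃ₐ[Y.FunctionField] Ω := IsSepClosure.equiv Y.FunctionField _ _
  let e : Y.SepClosure ≃ₐ[k] Ω := e₀.restrictScalars k
  have he (a) : e (algebraMap Y.FunctionField Y.SepClosure a) = ι a := e₀.commutes a
  obtain ⟨s', hs'⟩ := s.exists_transport (K' := Y.FunctionField) e fun τ a ↦ by rw [he, hι]
  obtain ⟨⟨V, hV⟩, hu⟩ := Y.bgasc_iff_isStablePlace.1 hY s'
  refine ⟨⟨_, hV.comap_symm hs'⟩, fun V₁ V₂ h₁ h₂ a ha ↦ ?_⟩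
  have h := SetLike.ext_iff.1 (hu _ _ (h₁.comap hs') (h₂.comap hs')) a
  simp only [ValuationSubring.mem_comap] at h
  change e _ ∈ V₁ ↔ e _ ∈ V₂ at h
  rw [he] at h
  exact h.1 ha

/-- The section conjecture for curves of genus `g`, applied to a double cover of the projective line
whose function field is fixed by the section. -/
theorem exists_isStablePlace_of_transcendental [Algebra.IsIntegral K Ω] (s : GaloisSection k K Ω)
    {g : ℕ} (hg : 1 ≤ g)
    (h : ∀ C : SmoothProperCurve k, C.genus = g → C.BGASC) {t : K} (ht : Transcendental k t)
    (halg : ∀ y : Ω, IsAlgebraic (IntermediateField.adjoin k {algebraMap K Ω t}) y) :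
    (∃ V, s.IsStablePlace V) ∧ ∀ V V', s.IsStablePlace V → s.IsStablePlace V' →
      algebraMap K Ω t ∈ V → algebraMap K Ω t ∈ V' := by
  have hb : t ^ (2 * g + 2) + 1 ≠ 0 := fun h0 ↦ ht
    ⟨Polynomial.X ^ (2 * g + 2) + Polynomial.C 1, Polynomial.X_pow_add_C_ne_zero (by omega) _, by
      simpa using h0⟩
  -- Without the twist by `c`, the square root of `t^(2g+2) + 1` need not be fixed by `s`, and `s`
  -- would not be a section for the double cover.
  obtain ⟨c, y, hc, hy, hfix⟩ := s.exists_twist hb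
  rw [map_add, map_pow, map_one] at hy
  obtain ⟨Y, ι, hY, hι⟩ := SmoothProperCurve.exists_genus_eq_and_fieldRange_eq
    ((transcendental_algebraMap_iff (R := k) (algebraMap K Ω).injective).2 ht) hg hc hy
  have hle : IntermediateField.adjoin k {algebraMap K Ω t} ≤ ι.fieldRange :=
    hι ▸ IntermediateField.adjoin.mono _ _ _ (by simp)
  have hfix' (τ a) : s.toHom τ (ι a) = ι a := by
    have ha : ι a ∈ IntermediateField.adjoin k {algebraMap K Ω t, y} := hι ▸ ⟨a, rfl⟩
    have hle : IntermediateField.adjoin k {algebraMap K Ω t, y} ≤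
        IntermediateField.fixedField (Subgroup.zpowers ((s.toHom τ).restrictScalars k)) := by
      rw [IntermediateField.adjoin_le_iff]
      intro z hz
      rw [SetLike.mem_coe, IntermediateField.mem_fixedField_iff]
      have hz' : (s.toHom τ).restrictScalars k ∈ MulAction.stabilizer Gal(Ω/k) z := by
        rw [MulAction.mem_stabilizer_iff]
        rcases hz with rfl | rfl
        · exact (s.toHom τ).commutes t
        · exact hfix τ
      exact fun σ hσ ↦ (Subgroup.zpowers_le.2 hz') hσ
    exact (IntermediateField.mem_fixedField_iff _ _).1 (hle ha) _ (Subgroup.mem_zpowers _)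
  obtain ⟨hex, hu⟩ := s.exists_isStablePlace_of_bgasc (h Y hY) ι hfix' fun z ↦ by
    obtain ⟨p, hp, hpz⟩ := halg z
    refine ⟨p.map (IntermediateField.inclusion hle).toRingHom,
      (Polynomial.map_ne_zero_iff (IntermediateField.inclusion hle).injective).2 hp, ?_⟩
    rw [Polynomial.aeval_def, Polynomial.eval₂_map]
    exact hpz
  refine ⟨hex, fun V V' hV hV' htV ↦ ?_⟩
  obtain ⟨a, ha⟩ := hle (IntermediateField.mem_adjoin_simple_self k (algebraMap K Ω t))
  have ha' : ι a = algebraMap K Ω t := ha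
  rw [← ha'] at htV ⊢
  exact hu V V' hV hV' a htV

end GaloisSection

theorem corollary2p3 {k : Type u} [Field k] [CharZero k]
    (hk : (⊤ : IntermediateField ℚ k).FG) (g : ℕ) (hg : 1 ≤ g)
    (h : ∀ C : SmoothProperCurve k, C.genus = g → C.BGASC) :
    ∀ C : SmoothProperCurve k, C.BGASC := by
  intro C
  rw [C.bgasc_iff_isStablePlace]
  intro s
  have key {t : C.FunctionField} (ht : Transcendental k t) :=
    s.exists_isStablePlace_of_transcendental hg h ht fun y ↦
      .of_adjoin_simple (C.exists_transcendental.2 t ht) y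
  obtain ⟨t, ht⟩ := C.exists_transcendental.1
  refine ⟨(key ht).1, ?_⟩
  have hle (V V') (hV : s.IsStablePlace V) (hV' : s.IsStablePlace V') :
      V.comap (algebraMap C.FunctionField C.SepClosure) ≤
        V'.comap (algebraMap C.FunctionField C.SepClosure) := by
    intro a ha
    -- The auxiliary curve varies with `a`: each transcendental element is tested on its own double
    -- cover, and algebraic elements lie in every stable place.
    by_cases hat : Transcendental k a
    · exact (key hat).2 V V' hV hV' ha
    · exact V'.algebraicClosure_mem (k := k) hV'.algebraMap_mem
        ((isAlgebraic_algebraMap_iff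
          (algebraMap C.FunctionField C.SepClosure).injective).2 (not_not.1 hat))
  exact fun V V' hV hV' ↦ le_antisymm (hle V V' hV hV') (hle V' V hV' hV)
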